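/- Let $\mu>0$ and let $\phi$ be the ground state, i.e. the positive solution of $-\phi''+\mu\phi-\phi^3=0$ on $(0,1)$, $\phi(0)=\phi(1)=0$. Let $M$ be the operator $$M=\begin{pmatrix}\frac{d^2}{dx^2}-\mu&0\\0&-\frac{d^2}{dx^2}+\mu\end{pmatrix}+\phi^2\begin{pmatrix}2&-1\\1&-2\end{pmatrix}$$ in $L^2((0,1);\mathbb C^2)$ with zero boundary conditions (domain $[H^2(0,1)\cap H^1_0(0,1)]^2$). Let $0<\beta_2\le\beta_3\le\cdots$ be the positive eigenvalues of $M$, listed in nondecreasing order and repeated according to multiplicity (dimension of the eigenspace). Then there exist an index $n_0\in\mathbb N$, $n_0\ge 2$, and a constant $C>0$ such that for all $n\ge n_0$ one has $\beta_n>\mu$, and every eigenfunction $W_n^{+}$ of $M$ for the eigenvalue $\beta_n$ and every eigenfunction $W_n^{-}$ of $M$ for the eigenvalue $-\beta_n$, after multiplication by a suitable nonzero complex constant, satisfies $$\Bigl|W_n^+(x)-\sin\bigl(\sqrt{\beta_n-\mu}\,x\bigr)\tbinom{0}{1}\Bigr|\le\frac Cn,\qquad \Bigl|W_n^-(x)-\sin\bigl(\sqrt{\beta_n-\mu}\,x\bigr)\tbinom{1}{0}\Bigr|\le\frac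 Cn$$ for all $x\in[0,1]$, where $|\cdot|$ is the Euclidean norm of $\mathbb C^2$. -/

import Mathlib

open MeasureTheory Set

/-- `φ` is the ground state: the positive solution of
`-φ'' + μ φ - φ³ = 0` on `(0,1)`, `φ(0) = φ(1) = 0`. -/
structure IsGroundState (μ : ℝ) (φ : ℝ → ℝ) : Prop where
  continuousOn : ContinuousOn φ (Icc 0 1)
  contDiffOn : ContDiffOn ℝ 2 φ (Ioo 0 1)
  ode : ∀ x ∈ Ioo (0 : ℝ) 1, -deriv (deriv φ) x + μ * φ x - φ x ^ 3 = 0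
  left : φ 0 = 0
  right : φ 1 = 0
  pos : ∀ x ∈ Ioo (0 : ℝ) 1, 0 < φ x

/-- `u ∈ H²(0,1) ∩ H¹₀(0,1)` (continuous representative on `[0,1]`, extended by zero to `ℝ`), with
first derivative `u'` (absolutely continuous on `[0,1]`) and second derivative `u'' ∈ L²(0,1)`. -/
structure IsH2H10 (u u' u'' : ℝ → ℂ) : Prop where
  memLp : MemLp u'' 2 (volume.restrict (Ioc 0 1))
  deriv_eq : ∀ x ∈ Icc (0 : ℝ) 1, u' x = u' 0 + ∫ t in (0 : ℝ)..x, u'' t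
  eq_integral : ∀ x ∈ Icc (0 : ℝ) 1, u x = ∫ t in (0 : ℝ)..x, u' t
  right : u 1 = 0
  eq_zero_off : ∀ x, x ∉ Icc (0 : ℝ) 1 → u x = 0

theorem IsH2H10.zero : IsH2H10 0 0 0 := by
  constructor <;> simp

theorem IsH2H10.intervalIntegrable_snd {u u' u'' : ℝ → ℂ} (h : IsH2H10 u u' u'')
    {x : ℝ} (hx : x ∈ Icc (0 : ℝ) 1) : IntervalIntegrable u'' volume 0 x := by
  have h1 : IntegrableOn u'' (Ioc 0 1) := h.memLp.integrable (by norm_num)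
  rw [intervalIntegrable_iff_integrableOn_Ioc_of_le hx.1]
  exact h1.mono_set (Ioc_subset_Ioc_right hx.2)

theorem IsH2H10.intervalIntegrable_fst {u u' u'' : ℝ → ℂ} (h : IsH2H10 u u' u'')
    {x : ℝ} (hx : x ∈ Icc (0 : ℝ) 1) : IntervalIntegrable u' volume 0 x := by
  have h1 : ContinuousOn (fun x => u' 0 + ∫ t in (0 : ℝ)..x, u'' t) (Icc 0 1) := by
    have := intervalIntegral.continuousOn_primitive_interval
      (μ := volume) (f := u'') (a := 0) (b := 1) (by
        have h2 : IntegrableOn u'' (Ioc 0 1) := h.memLp.integrable (by norm_num)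
        rw [uIcc_of_le zero_le_one]
        exact (integrableOn_Icc_iff_integrableOn_Ioc).2 h2)
    rw [uIcc_of_le zero_le_one] at this
    exact continuousOn_const.add this
  have h2 : ContinuousOn u' (Icc 0 1) := h1.congr h.deriv_eq
  apply ContinuousOn.intervalIntegrable
  rw [uIcc_of_le hx.1]
  exact h2.mono (Icc_subset_Icc_right hx.2)

theorem IsH2H10.add {u u' u'' v v' v'' : ℝ → ℂ} (hu : IsH2H10 u u' u'') (hv : IsH2H10 v v' v'') :
    IsH2H10 (u + v) (u' + v') (u'' + v'') where
  memLp := hu.memLp.add hv.memLp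
  deriv_eq x hx := by
    simp only [Pi.add_apply]
    rw [intervalIntegral.integral_add (hu.intervalIntegrable_snd hx)
      (hv.intervalIntegrable_snd hx), hu.deriv_eq x hx, hv.deriv_eq x hx]
    ring
  eq_integral x hx := by
    simp only [Pi.add_apply]
    rw [intervalIntegral.integral_add (hu.intervalIntegrable_fst hx)
      (hv.intervalIntegrable_fst hx), hu.eq_integral x hx, hv.eq_integral x hx]
  right := by simp [hu.right, hv.right]
  eq_zero_off x hx := by simp [hu.eq_zero_off x hx, hv.eq_zero_off x hx]

theorem IsH2H10.smul (c : ℂ) {u u' u'' : ℝ → ℂ} (hu : IsH2H10 u u' u'') :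
    IsH2H10 (c • u) (c • u') (c • u'') where
  memLp := hu.memLp.const_smul c
  deriv_eq x hx := by
    simp only [Pi.smul_apply, smul_eq_mul, intervalIntegral.integral_const_mul]
    rw [hu.deriv_eq x hx]
    ring
  eq_integral x hx := by
    simp only [Pi.smul_apply, smul_eq_mul, intervalIntegral.integral_const_mul]
    rw [hu.eq_integral x hx]
  right := by simp [hu.right]
  eq_zero_off x hx := by simp [hu.eq_zero_off x hx]

/-- The space `ker (M - l)`, where `M` is the operator
`M (u, v) = (u'' - μ u + φ² (2 u - v), -v'' + μ v + φ² (u - 2 v))`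
in `L²(0,1)²` with domain `(H²(0,1) ∩ H¹₀(0,1))²`; elements are represented by their
continuous representatives on `[0,1]`, extended by zero. -/
def eigenspaceM (μ : ℝ) (φ : ℝ → ℝ) (l : ℂ) :
    Submodule ℂ (ℝ → EuclideanSpace ℂ (Fin 2)) where
  carrier := {W | ∃ u' u'' v' v'' : ℝ → ℂ,
    IsH2H10 (fun x => W x 0) u' u'' ∧ IsH2H10 (fun x => W x 1) v' v'' ∧
    ∀ᵐ x ∂(volume.restrict (Ioo (0 : ℝ) 1)),
      u'' x - μ * W x 0 + (φ x : ℂ) ^ 2 * (2 * W x 0 - W x 1) = l * W x 0 ∧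
      -v'' x + μ * W x 1 + (φ x : ℂ) ^ 2 * (W x 0 - 2 * W x 1) = l * W x 1}
  zero_mem' := ⟨0, 0, 0, 0, IsH2H10.zero, IsH2H10.zero, by simp⟩
  add_mem' := by
    rintro W Z ⟨u', u'', v', v'', hu, hv, h⟩ ⟨p', p'', q', q'', hp, hq, k⟩
    refine ⟨u' + p', u'' + p'', v' + q', v'' + q'', hu.add hp, hv.add hq, ?_⟩
    filter_upwards [h, k] with x hx kx
    simp only [Pi.add_apply, PiLp.add_apply]
    exact ⟨by linear_combination hx.1 + kx.1, by linear_combination hx.2 + kx.2⟩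
  smul_mem' := by
    rintro c W ⟨u', u'', v', v'', hu, hv, h⟩
    refine ⟨c • u', c • u'', c • v', c • v'', hu.smul c, hv.smul c, ?_⟩
    filter_upwards [h] with x hx
    simp only [Pi.smul_apply, PiLp.smul_apply, smul_eq_mul]
    exact ⟨by linear_combination c * hx.1, by linear_combination c * hx.2⟩

/-- `W` is an eigenfunction of `M` for the eigenvalue `l`. -/
def IsEigenfunctionM (μ : ℝ) (φ : ℝ → ℝ) (l : ℂ) (W : ℝ → EuclideanSpace ℂ (Fin 2)) : Prop :=
  W ∈ eigenspaceM μ φ l ∧ W ≠ 0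

/-- `β 2 ≤ β 3 ≤ …` is the list of all positive eigenvalues of `M`, in nondecreasing order and
repeated according to multiplicity. (The list starts at `2`; the values `β 0`, `β 1`
play no role.) -/
structure IsPosEigenvalueList (μ : ℝ) (φ : ℝ → ℝ) (β : ℕ → ℝ) : Prop where
  pos : ∀ n, 2 ≤ n → 0 < β n
  mono : ∀ m n, 2 ≤ m → m ≤ n → β m ≤ β n
  mult : ∀ b : ℝ, 0 < b →
    {n : ℕ | 2 ≤ n ∧ β n = b}.encard = (Module.finrank ℂ (eigenspaceM μ φ (b : ℂ)) : ℕ∞)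

/-!
The idea is to bring `M` into the form of two coupled scalar equations and to treat
the terms with `φ²` as a bounded perturbation.

*Shape of the eigenfunctions.* Let `b > μ` be an eigenvalue with eigenfunction `(u, v)` and put
`k² = b - μ`, `κ² = b + μ`. The equations are
`u'' = κ² u - φ² (2u - v)` and `v'' = -k² v + φ² (u - 2v)`. The first one is elliptic, and its
energy identity makes `u` of size `O(1/k)` relative to `v`
(`IsC2Dirichlet.norm_le_div`); variation of constants in the second one shows that `v` is
`(v' 0 / k) sin (k x)` up to a relative error `O(1/k)` (`IsC2Dirichlet.norm_mul_sub_sin_le`).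
Dividing by `v' 0 / k`, which cannot vanish when `k` is large, gives `exists_mul_near_sin`. For the
eigenvalue `-b` the same system holds with `u` and `v` exchanged.

*Growth of the eigenvalues.* It remains to see that `√(β_n - μ)` grows at least linearly in `n`.
The operator `M` is not self-adjoint, so this is proved by a trace argument. The energy identities
give the resolvent estimate `|W(x)|² ≤ 5 s⁻³ ‖(M - i s²) W‖²` for large `s`
(`ClassicalM.resolvent_estimate`). Hence on the span of `N` linearly independent eigenfunctions
the resolvent has squared Hilbert–Schmidt norm at most `10 s⁻³` by duality, and its trace has
square at most `10 N s⁻³` (`norm_trace_sq_le`). If all the eigenvalues involved lie in `[0, s²]`,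
the trace, which is `∑ (b_j - i s²)⁻¹`, has imaginary part at least `N / (2 s²)`. Therefore
`N ≤ 40 s` (`card_le_of_linearIndependent_eigenspaceM`), and `n - 1 ≤ 40 √(β_n + 4 max φ²)`.
-/

open scoped ComplexConjugate InnerProductSpace

/-! ### Classical regularity -/

/-- `u` is of class `C²` on `[0,1]` with derivatives `u'` and `u''`, and vanishes at both ends.
The derivatives are only required in the open interval, but all three functions are continuous up
to the boundary. -/
structure IsC2Dirichlet (u u' u'' : ℝ → ℂ) : Prop where
  cont : ContinuousOn u (Icc 0 1)
  cont' : ContinuousOn u' (Icc 0 1)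
  cont'' : ContinuousOn u'' (Icc 0 1)
  hasDerivAt : ∀ x ∈ Ioo (0 : ℝ) 1, HasDerivAt u (u' x) x
  hasDerivAt' : ∀ x ∈ Ioo (0 : ℝ) 1, HasDerivAt u' (u'' x) x
  left : u 0 = 0
  right : u 1 = 0

theorem IsC2Dirichlet.zero : IsC2Dirichlet 0 0 0 := by
  constructor
  · exact continuousOn_const
  · exact continuousOn_const
  · exact continuousOn_const
  · exact fun x _ => hasDerivAt_const x 0
  · exact fun x _ => hasDerivAt_const x 0
  · rfl
  · rfl

theorem IsC2Dirichlet.add {u u' u'' v v' v'' : ℝ → ℂ} (hu : IsC2Dirichlet u u' u'')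
    (hv : IsC2Dirichlet v v' v'') : IsC2Dirichlet (u + v) (u' + v') (u'' + v'') where
  cont := hu.cont.add hv.cont
  cont' := hu.cont'.add hv.cont'
  cont'' := hu.cont''.add hv.cont''
  hasDerivAt x hx := (hu.hasDerivAt x hx).add (hv.hasDerivAt x hx)
  hasDerivAt' x hx := (hu.hasDerivAt' x hx).add (hv.hasDerivAt' x hx)
  left := by simp [hu.left, hv.left]
  right := by simp [hu.right, hv.right]

theorem IsC2Dirichlet.smul (c : ℂ) {u u' u'' : ℝ → ℂ} (hu : IsC2Dirichlet u u' u'') :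
    IsC2Dirichlet (c • u) (c • u') (c • u'') where
  cont := hu.cont.const_smul c
  cont' := hu.cont'.const_smul c
  cont'' := hu.cont''.const_smul c
  hasDerivAt x hx := (hu.hasDerivAt x hx).const_smul c
  hasDerivAt' x hx := (hu.hasDerivAt' x hx).const_smul c
  left := by simp [hu.left]
  right := by simp [hu.right]

theorem IsH2H10.continuousOn' {u u' u'' : ℝ → ℂ} (h : IsH2H10 u u' u'') :
    ContinuousOn u' (Icc 0 1) := by
  have h1 : ContinuousOn (fun x => u' 0 + ∫ t in (0 : ℝ)..x, u'' t) (Icc 0 1) := by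
    have := intervalIntegral.continuousOn_primitive_interval
      (μ := volume) (f := u'') (a := 0) (b := 1) (by
        have h2 : IntegrableOn u'' (Ioc 0 1) := h.memLp.integrable (by norm_num)
        rw [uIcc_of_le zero_le_one]
        exact (integrableOn_Icc_iff_integrableOn_Ioc).2 h2)
    rw [uIcc_of_le zero_le_one] at this
    exact continuousOn_const.add this
  exact h1.congr h.deriv_eq

theorem IsH2H10.continuousOn {u u' u'' : ℝ → ℂ} (h : IsH2H10 u u' u'') :
    ContinuousOn u (Icc 0 1) := by
  have := intervalIntegral.continuousOn_primitive_interval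
      (μ := volume) (f := u') (a := 0) (b := 1) (by
        rw [uIcc_of_le zero_le_one]
        exact h.continuousOn'.integrableOn_Icc)
  rw [uIcc_of_le zero_le_one] at this
  exact this.congr h.eq_integral

theorem hasDerivAt_of_eq_integral {u u' : ℝ → ℂ} {c : ℂ} (hu' : ContinuousOn u' (Icc 0 1))
    (h : ∀ x ∈ Icc (0 : ℝ) 1, u x = c + ∫ t in (0 : ℝ)..x, u' t) {x : ℝ}
    (hx : x ∈ Ioo (0 : ℝ) 1) : HasDerivAt u (u' x) x := by
  have h1 : IntervalIntegrable u' volume 0 x := by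
    apply ContinuousOn.intervalIntegrable
    rw [uIcc_of_le hx.1.le]
    exact hu'.mono (Icc_subset_Icc_right hx.2.le)
  have hn : Icc (0 : ℝ) 1 ∈ nhds x := Icc_mem_nhds hx.1 hx.2
  have h2 : HasDerivAt (fun y => c + ∫ t in (0 : ℝ)..y, u' t) (u' x) x :=
    (intervalIntegral.integral_hasDerivAt_right h1
      (hu'.stronglyMeasurableAtFilter_nhdsWithin measurableSet_Icc x |>.filter_mono
        (by rw [nhdsWithin_eq_nhds.2 hn]))
      (hu'.continuousAt hn)).const_add c
  refine h2.congr_of_eventuallyEq ?_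
  filter_upwards [hn] with y hy using h y hy

/-- If the weak second derivative of a function in `H² ∩ H¹₀` agrees almost everywhere with a
function continuous on `[0,1]`, then the function is classically `C²`. -/
theorem IsH2H10.isC2Dirichlet {u u' u'' g : ℝ → ℂ} (h : IsH2H10 u u' u'')
    (hg : ContinuousOn g (Icc 0 1)) (hae : u'' =ᵐ[volume.restrict (Ioo (0 : ℝ) 1)] g) :
    IsC2Dirichlet u u' g where
  cont := h.continuousOn
  cont' := h.continuousOn'
  cont'' := hg
  hasDerivAt x hx := hasDerivAt_of_eq_integral (c := 0) h.continuousOn'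
    (fun y hy => by rw [h.eq_integral y hy, zero_add]) hx
  hasDerivAt' x hx := hasDerivAt_of_eq_integral (c := u' 0) hg (fun y hy => by
    rw [h.deriv_eq y hy]
    congr 1
    refine intervalIntegral.integral_congr_ae_restrict ?_
    rw [uIoc_of_le hy.1]
    rw [restrict_Ioo_eq_restrict_Ioc] at hae
    exact ae_restrict_of_ae_restrict_of_subset (Ioc_subset_Ioc_right hy.2) hae) hx
  left := by simpa using h.eq_integral 0 (by simp)
  right := h.right

/-! ### The operator in classical form -/

/-- The relation `M W = G` in classical form: the components of `W` are of class `C²` on `[0,1]`,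
vanish at the ends and satisfy the two second-order equations, solved for `W''`; moreover `W`
vanishes off `[0,1]`. -/
def ClassicalM (μ : ℝ) (φ : ℝ → ℝ) (W G : ℝ → EuclideanSpace ℂ (Fin 2)) : Prop :=
  (∃ u' v' : ℝ → ℂ,
    IsC2Dirichlet (fun x => W x 0) u'
      (fun x => μ * W x 0 - (φ x : ℂ) ^ 2 * (2 * W x 0 - W x 1) + G x 0) ∧
    IsC2Dirichlet (fun x => W x 1) v'
      (fun x => μ * W x 1 + (φ x : ℂ) ^ 2 * (W x 0 - 2 * W x 1) - G x 1)) ∧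
  ∀ x, x ∉ Icc (0 : ℝ) 1 → W x = 0

section ClassicalM

variable {μ : ℝ} {φ : ℝ → ℝ}

theorem ClassicalM.zero : ClassicalM μ φ 0 0 := by
  refine ⟨⟨0, 0, ?_, ?_⟩, fun _ _ => rfl⟩ <;>
  · convert IsC2Dirichlet.zero using 1 <;> ext x <;> simp

theorem ClassicalM.add {W G Z H : ℝ → EuclideanSpace ℂ (Fin 2)} (hW : ClassicalM μ φ W G)
    (hZ : ClassicalM μ φ Z H) : ClassicalM μ φ (W + Z) (G + H) := by
  obtain ⟨⟨u', v', hu, hv⟩, h0⟩ := hW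
  obtain ⟨⟨p', q', hp, hq⟩, k0⟩ := hZ
  refine ⟨⟨u' + p', v' + q', ?_, ?_⟩, fun x hx => by simp [h0 x hx, k0 x hx]⟩
  · convert hu.add hp using 1
    · rfl
    · ext x
      simp only [Pi.add_apply, PiLp.add_apply]
      ring
  · convert hv.add hq using 1
    · rfl
    · ext x
      simp only [Pi.add_apply, PiLp.add_apply]
      ring

theorem ClassicalM.smul (c : ℂ) {W G : ℝ → EuclideanSpace ℂ (Fin 2)} (hW : ClassicalM μ φ W G) :
    ClassicalM μ φ (c • W) (c • G) := by
  obtain ⟨⟨u', v', hu, hv⟩, h0⟩ := hW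
  refine ⟨⟨c • u', c • v', ?_, ?_⟩, fun x hx => by simp [h0 x hx]⟩
  · convert hu.smul c using 1
    · rfl
    · ext x
      simp only [Pi.smul_apply, PiLp.smul_apply, smul_eq_mul]
      ring
  · convert hv.smul c using 1
    · rfl
    · ext x
      simp only [Pi.smul_apply, PiLp.smul_apply, smul_eq_mul]
      ring

theorem ClassicalM.sum {ι : Type*} (s : Finset ι) {W G : ι → ℝ → EuclideanSpace ℂ (Fin 2)}
    (h : ∀ i ∈ s, ClassicalM μ φ (W i) (G i)) :
    ClassicalM μ φ (∑ i ∈ s, W i) (∑ i ∈ s, G i) := by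
  classical
  induction s using Finset.induction_on with
  | empty => simpa using ClassicalM.zero
  | insert a s ha ih =>
    rw [Finset.sum_insert ha, Finset.sum_insert ha]
    exact (h a (Finset.mem_insert_self a s)).add
      (ih fun i hi => h i (Finset.mem_insert_of_mem hi))

theorem continuousOn_euclidean {W : ℝ → EuclideanSpace ℂ (Fin 2)} {s : Set ℝ}
    (h0 : ContinuousOn (fun x => W x 0) s) (h1 : ContinuousOn (fun x => W x 1) s) :
    ContinuousOn W s := by
  have : ContinuousOn (fun x => WithLp.toLp 2 (WithLp.ofLp (W x))) s := by
    refine (PiLp.continuous_toLp 2 _).comp_continuousOn (continuousOn_pi.2 fun i => ?_)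
    fin_cases i
    · exact h0
    · exact h1
  exact this

theorem ClassicalM.continuousOn {W G : ℝ → EuclideanSpace ℂ (Fin 2)} (hW : ClassicalM μ φ W G) :
    ContinuousOn W (Icc 0 1) := by
  obtain ⟨⟨u', v', hu, hv⟩, h0⟩ := hW
  exact continuousOn_euclidean hu.cont hv.cont

theorem classicalM_of_mem_eigenspaceM (hφ : ContinuousOn φ (Icc 0 1)) {l : ℂ}
    {W : ℝ → EuclideanSpace ℂ (Fin 2)} (h : W ∈ eigenspaceM μ φ l) :
    ClassicalM μ φ W (l • W) := by
  obtain ⟨u', u'', v', v'', hu, hv, hae⟩ := h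
  have hφ' : ContinuousOn (fun x => (φ x : ℂ)) (Icc 0 1) :=
    Complex.continuous_ofReal.comp_continuousOn hφ
  have hu0 := hu.continuousOn
  have hv0 := hv.continuousOn
  refine ⟨⟨u', v', hu.isC2Dirichlet ?_ ?_, hv.isC2Dirichlet ?_ ?_⟩, fun x hx => ?_⟩
  · simp only [Pi.smul_apply, PiLp.smul_apply, smul_eq_mul]
    fun_prop
  · filter_upwards [hae] with x hx
    simp only [Pi.smul_apply, PiLp.smul_apply, smul_eq_mul]
    linear_combination hx.1
  · simp only [Pi.smul_apply, PiLp.smul_apply, smul_eq_mul]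
    fun_prop
  · filter_upwards [hae] with x hx
    simp only [Pi.smul_apply, PiLp.smul_apply, smul_eq_mul]
    linear_combination -hx.2
  · ext i
    fin_cases i
    · exact hu.eq_zero_off x hx
    · exact hv.eq_zero_off x hx

/-! ### Independence of eigenfunctions -/

theorem IsC2Dirichlet.eq_zero_of_forall {u u' u'' : ℝ → ℂ} (h : IsC2Dirichlet u u' u'')
    (hu : ∀ x, u x = 0) {x : ℝ} (hx : x ∈ Ioo (0 : ℝ) 1) : u'' x = 0 := by
  have hu0 : u = fun _ => 0 := funext hu
  have h1 : ∀ y ∈ Ioo (0 : ℝ) 1, u' y = 0 := fun y hy => by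
    have := h.hasDerivAt y hy
    rw [hu0] at this
    exact this.unique (hasDerivAt_const y 0)
  refine (h.hasDerivAt' x hx).unique ((hasDerivAt_const x (0 : ℂ)).congr_of_eventuallyEq ?_)
  filter_upwards [Ioo_mem_nhds hx.1 hx.2] with y hy using h1 y hy

theorem ClassicalM.eqOn_zero {G : ℝ → EuclideanSpace ℂ (Fin 2)} (h : ClassicalM μ φ 0 G)
    {x : ℝ} (hx : x ∈ Ioo (0 : ℝ) 1) : G x = 0 := by
  obtain ⟨⟨u', v', hu, hv⟩, -⟩ := h
  have h0 := hu.eq_zero_of_forall (by simp) hx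
  have h1 := hv.eq_zero_of_forall (by simp) hx
  ext i
  fin_cases i
  · simpa using h0
  · simpa using h1

theorem eq_zero_of_eqOn_Ioo {W : ℝ → EuclideanSpace ℂ (Fin 2)}
    (hc : ContinuousOn W (Icc 0 1)) (h0 : ∀ x, x ∉ Icc (0 : ℝ) 1 → W x = 0)
    (h : ∀ x ∈ Ioo (0 : ℝ) 1, W x = 0) : W = 0 := by
  have h1 : EqOn W 0 (Icc 0 1) := by
    have : EqOn W 0 (Ioo 0 1) := h
    refine this.of_subset_closure hc continuousOn_const Ioo_subset_Icc_self ?_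
    rw [closure_Ioo (by norm_num)]
  ext1 x
  by_cases hx : x ∈ Icc (0 : ℝ) 1
  · exact h1 hx
  · exact h0 x hx

/-- Eigenfunctions of `M` for distinct eigenvalues are linearly independent. -/
theorem eq_zero_of_sum_eigenspaceM_eq_zero (hφ : ContinuousOn φ (Icc 0 1)) (s : Finset ℝ) :
    ∀ W : ℝ → ℝ → EuclideanSpace ℂ (Fin 2), (∀ b ∈ s, W b ∈ eigenspaceM μ φ (b : ℂ)) →
      ∑ b ∈ s, W b = 0 → ∀ b ∈ s, W b = 0 := by
  classical
  induction s using Finset.induction_on with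
  | empty => simp
  | insert a s ha ih =>
    intro W hW hsum
    have hcl : ∀ b ∈ insert a s, ClassicalM μ φ (W b) ((b : ℂ) • W b) := fun b hb =>
      classicalM_of_mem_eigenspaceM hφ (hW b hb)
    -- Applying `M - a` to the relation removes the term belonging to `a`.
    have h1 : ∑ b ∈ s, ((b : ℂ) - a) • W b = 0 := by
      have h2 := ClassicalM.sum _ hcl
      have hcc : ∀ b ∈ s, ContinuousOn (W b) (Icc 0 1) := fun b hb =>
        (hcl b (Finset.mem_insert_of_mem hb)).continuousOn
      rw [hsum] at h2
      refine eq_zero_of_eqOn_Ioo ?_ ?_ ?_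
      · have : (∑ b ∈ s, ((b : ℂ) - a) • W b) = fun x => ∑ b ∈ s, ((b : ℂ) - a) • W b x := by
          ext1 x
          simp
        rw [this]
        exact continuousOn_finsetSum _ fun b hb => ContinuousOn.const_smul (hcc b hb) ((b : ℂ) - a)
      · intro x hx
        rw [Finset.sum_apply]
        refine Finset.sum_eq_zero fun b hb => ?_
        simp [(hcl b (Finset.mem_insert_of_mem hb)).2 x hx]
      · intro x hx
        have h3 := h2.eqOn_zero hx
        have h4 := congrFun hsum x
        rw [Finset.sum_insert ha] at h3 h4
        simp only [Pi.add_apply, Finset.sum_apply, Pi.smul_apply, Pi.zero_apply] at h3 h4 ⊢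
        simp only [sub_smul, Finset.sum_sub_distrib]
        rw [← Finset.smul_sum, eq_neg_of_add_eq_zero_right h4, eq_neg_of_add_eq_zero_right h3]
        simp
    have h5 := ih (fun b => ((b : ℂ) - a) • W b)
      (fun b hb => Submodule.smul_mem _ _ (hW b (Finset.mem_insert_of_mem hb))) h1
    have h6 : ∀ b ∈ s, W b = 0 := fun b hb => by
      refine (smul_eq_zero.1 (h5 b hb)).resolve_left ?_
      exact fun h => ha (Complex.ofReal_injective (sub_eq_zero.1 h) ▸ hb)
    intro b hb
    rcases Finset.mem_insert.1 hb with rfl | hb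
    · rw [Finset.sum_insert ha, Finset.sum_eq_zero h6, add_zero] at hsum
      exact hsum
    · exact h6 b hb

end ClassicalM

/-! ### Energy identities on the unit interval -/

theorem integral_le_of_continuousOn {f g : ℝ → ℝ} (hf : ContinuousOn f (Icc 0 1))
    (hg : ContinuousOn g (Icc 0 1)) (h : ∀ x ∈ Icc (0 : ℝ) 1, f x ≤ g x) :
    ∫ x in (0 : ℝ)..1, f x ≤ ∫ x in (0 : ℝ)..1, g x :=
  intervalIntegral.integral_mono_on zero_le_one (hf.intervalIntegrable_of_Icc zero_le_one)
    (hg.intervalIntegrable_of_Icc zero_le_one) h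

namespace IsC2Dirichlet

variable {u u' u'' : ℝ → ℂ}

theorem continuousOn_mul_conj (h : IsC2Dirichlet u u' u'') :
    ContinuousOn (fun x => u'' x * conj (u x)) (Icc 0 1) :=
  h.cont''.mul (Complex.continuous_conj.comp_continuousOn h.cont)

theorem integral_mul_conj (h : IsC2Dirichlet u u' u'') :
    ∫ x in (0 : ℝ)..1, u'' x * conj (u x) = -((∫ x in (0 : ℝ)..1, ‖u' x‖ ^ 2 : ℝ) : ℂ) := by
  have hc' := h.cont'
  have hconj : ContinuousOn (fun x => conj (u x)) (Icc 0 1) :=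
    Complex.continuous_conj.comp_continuousOn h.cont
  have h1 : ContinuousOn (fun x => ((‖u' x‖ ^ 2 : ℝ) : ℂ)) (Icc 0 1) :=
    Complex.continuous_ofReal.comp_continuousOn (hc'.norm.pow 2)
  have h2 : ∫ x in (0 : ℝ)..1, (u'' x * conj (u x) + ((‖u' x‖ ^ 2 : ℝ) : ℂ)) =
      u' 1 * conj (u 1) - u' 0 * conj (u 0) := by
    refine intervalIntegral.integral_eq_sub_of_hasDerivAt_of_le
      (f := fun x => u' x * conj (u x)) zero_le_one (hc'.mul hconj) ?_ ?_
    · intro x hx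
      have h3 : HasDerivAt (fun x => conj (u x)) (conj (u' x)) x := (h.hasDerivAt x hx).star
      refine ((h.hasDerivAt' x hx).mul h3).congr_deriv ?_
      rw [← Complex.normSq_eq_norm_sq, ← Complex.mul_conj]
    · exact (h.continuousOn_mul_conj.add h1).intervalIntegrable_of_Icc zero_le_one
  rw [intervalIntegral.integral_add (h.continuousOn_mul_conj.intervalIntegrable_of_Icc zero_le_one)
    (h1.intervalIntegrable_of_Icc zero_le_one), h.left, h.right,
    intervalIntegral.integral_ofReal] at h2
  simp only [map_zero, mul_zero, sub_zero] at h2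
  exact eq_neg_of_add_eq_zero_left h2

theorem integral_re_mul_conj (h : IsC2Dirichlet u u' u'') :
    ∫ x in (0 : ℝ)..1, (u'' x * conj (u x)).re = -∫ x in (0 : ℝ)..1, ‖u' x‖ ^ 2 := by
  have := intervalIntegral.intervalIntegral_re
    (h.continuousOn_mul_conj.intervalIntegrable_of_Icc (μ := volume) zero_le_one)
  simp only [RCLike.re_eq_complex_re] at this
  rw [this, h.integral_mul_conj]
  simp

theorem integral_im_mul_conj (h : IsC2Dirichlet u u' u'') :
    ∫ x in (0 : ℝ)..1, (u'' x * conj (u x)).im = 0 := by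
  have := intervalIntegral.intervalIntegral_im
    (h.continuousOn_mul_conj.intervalIntegrable_of_Icc (μ := volume) zero_le_one)
  simp only [RCLike.im_eq_complex_im] at this
  rw [this, h.integral_mul_conj]
  simp

theorem continuousOn_re_mul_conj (h : IsC2Dirichlet u u' u'') :
    ContinuousOn (fun x => (u'' x * conj (u x)).re) (Icc 0 1) :=
  Complex.continuous_re.comp_continuousOn h.continuousOn_mul_conj

theorem continuousOn_im_mul_conj (h : IsC2Dirichlet u u' u'') :
    ContinuousOn (fun x => (u'' x * conj (u x)).im) (Icc 0 1) :=
  Complex.continuous_im.comp_continuousOn h.continuousOn_mul_conj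

theorem integral_im_sub_im (hu : IsC2Dirichlet u u' u'') {v v' v'' : ℝ → ℂ}
    (hv : IsC2Dirichlet v v' v'') :
    ∫ x in (0 : ℝ)..1, ((u'' x * conj (u x)).im - (v'' x * conj (v x)).im) = 0 := by
  rw [intervalIntegral.integral_sub
    (hu.continuousOn_im_mul_conj.intervalIntegrable_of_Icc zero_le_one)
    (hv.continuousOn_im_mul_conj.intervalIntegrable_of_Icc zero_le_one),
    hu.integral_im_mul_conj, hv.integral_im_mul_conj, sub_zero]

theorem integral_re_add_re (hu : IsC2Dirichlet u u' u'') {v v' v'' : ℝ → ℂ}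
    (hv : IsC2Dirichlet v v' v'') :
    ∫ x in (0 : ℝ)..1, ((u'' x * conj (u x)).re + (v'' x * conj (v x)).re) =
      -((∫ x in (0 : ℝ)..1, ‖u' x‖ ^ 2) + ∫ x in (0 : ℝ)..1, ‖v' x‖ ^ 2) := by
  rw [intervalIntegral.integral_add
    (hu.continuousOn_re_mul_conj.intervalIntegrable_of_Icc zero_le_one)
    (hv.continuousOn_re_mul_conj.intervalIntegrable_of_Icc zero_le_one),
    hu.integral_re_mul_conj, hv.integral_re_mul_conj, neg_add]

/-- A one-dimensional Sobolev inequality with a free scale `s`. -/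
theorem norm_sq_le (h : IsC2Dirichlet u u' u'') {s : ℝ} (hs : 0 < s) {x : ℝ}
    (hx : x ∈ Icc (0 : ℝ) 1) :
    ‖u x‖ ^ 2 ≤ s * (∫ t in (0 : ℝ)..1, ‖u t‖ ^ 2) + s⁻¹ * ∫ t in (0 : ℝ)..1, ‖u' t‖ ^ 2 := by
  have hc := h.cont
  have hc' := h.cont'
  have h1 : ContinuousOn (fun t => s * ‖u t‖ ^ 2 + s⁻¹ * ‖u' t‖ ^ 2) (Icc 0 1) := by fun_prop
  have h2 : ContinuousOn (fun t => 2 * inner ℝ (u t) (u' t)) (Icc 0 1) :=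
    continuousOn_const.mul (hc.inner hc')
  have hsub : Icc 0 x ⊆ Icc 0 1 := Icc_subset_Icc_right hx.2
  have h3 : ∫ t in (0 : ℝ)..x, 2 * inner ℝ (u t) (u' t) = ‖u x‖ ^ 2 - ‖u 0‖ ^ 2 := by
    refine intervalIntegral.integral_eq_sub_of_hasDerivAt_of_le (f := fun t => ‖u t‖ ^ 2)
      hx.1 ((hc.norm.pow 2).mono hsub) ?_ ?_
    · exact fun t ht => (h.hasDerivAt t ⟨ht.1, ht.2.trans_le hx.2⟩).norm_sq
    · exact (h2.mono hsub).intervalIntegrable_of_Icc hx.1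
  have h4 : ∫ t in (0 : ℝ)..x, 2 * inner ℝ (u t) (u' t) ≤
      ∫ t in (0 : ℝ)..x, (s * ‖u t‖ ^ 2 + s⁻¹ * ‖u' t‖ ^ 2) := by
    refine intervalIntegral.integral_mono_on hx.1
      ((h2.mono hsub).intervalIntegrable_of_Icc hx.1)
      ((h1.mono hsub).intervalIntegrable_of_Icc hx.1) fun t _ => ?_
    have h5 := real_inner_le_norm (u t) (u' t)
    have h6 : 2 * (‖u t‖ * ‖u' t‖) ≤ s * ‖u t‖ ^ 2 + s⁻¹ * ‖u' t‖ ^ 2 := by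
      have : s * ‖u t‖ ^ 2 + s⁻¹ * ‖u' t‖ ^ 2 - 2 * (‖u t‖ * ‖u' t‖) =
          s⁻¹ * (s * ‖u t‖ - ‖u' t‖) ^ 2 := by
        field_simp
        ring
      have : 0 ≤ s⁻¹ * (s * ‖u t‖ - ‖u' t‖) ^ 2 := by positivity
      linarith
    linarith
  have h7 : ∫ t in (0 : ℝ)..x, (s * ‖u t‖ ^ 2 + s⁻¹ * ‖u' t‖ ^ 2) ≤
      ∫ t in (0 : ℝ)..1, (s * ‖u t‖ ^ 2 + s⁻¹ * ‖u' t‖ ^ 2) := by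
    refine intervalIntegral.integral_mono_interval le_rfl hx.1 hx.2
      (Filter.Eventually.of_forall fun t => ?_) (h1.intervalIntegrable_of_Icc zero_le_one)
    simp only [Pi.zero_apply]
    positivity
  have h8 : ∫ t in (0 : ℝ)..1, (s * ‖u t‖ ^ 2 + s⁻¹ * ‖u' t‖ ^ 2) =
      s * (∫ t in (0 : ℝ)..1, ‖u t‖ ^ 2) + s⁻¹ * ∫ t in (0 : ℝ)..1, ‖u' t‖ ^ 2 := by
    rw [intervalIntegral.integral_add, intervalIntegral.integral_const_mul,
      intervalIntegral.integral_const_mul] <;>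
    exact ContinuousOn.intervalIntegrable_of_Icc zero_le_one (by fun_prop)
  rw [h.left, norm_zero] at h3
  linarith

end IsC2Dirichlet

/-! ### The resolvent estimate -/

theorem abs_im_mul_conj_le (z w : ℂ) : |(z * conj w).im| ≤ ‖z‖ * ‖w‖ :=
  (Complex.abs_im_le_norm _).trans (by simp)

theorem abs_re_mul_conj_le (z w : ℂ) : |(z * conj w).re| ≤ ‖z‖ * ‖w‖ :=
  (Complex.abs_re_le_norm _).trans (by simp)

theorem mul_le_div_add_mul {t : ℝ} (ht : 0 < t) (a b : ℝ) :
    a * b ≤ a ^ 2 / t + t / 4 * b ^ 2 := by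
  have : a ^ 2 / t + t / 4 * b ^ 2 - a * b = (a - t / 2 * b) ^ 2 / t := by
    field_simp
    ring
  have : 0 ≤ (a - t / 2 * b) ^ 2 / t := by positivity
  linarith

/-- Pointwise form of the imaginary part of the energy identity for `(M - i t) W = G`, with
`W = (U, V)`, `G = (G₀, G₁)` and `p = φ²`; the densities of the two components are subtracted
because `i t` enters the two equations with opposite signs. -/
theorem im_energy_density_ge {μ p Φ t : ℝ} (hp : 0 ≤ p) (hpΦ : p ≤ Φ) (ht : 4 * Φ ≤ t)
    (ht0 : 0 < t) (U V G₀ G₁ : ℂ) :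
    t / 2 * (‖U‖ ^ 2 + ‖V‖ ^ 2) - (‖G₀‖ ^ 2 + ‖G₁‖ ^ 2) / t ≤
      ((μ * U - p * (2 * U - V) + (G₀ + t * Complex.I * U)) * conj U).im -
      ((μ * V + p * (U - 2 * V) - (G₁ + t * Complex.I * V)) * conj V).im := by
  have e1 : ((μ * U - p * (2 * U - V) + (G₀ + t * Complex.I * U)) * conj U).im =
      p * (V * conj U).im + (G₀ * conj U).im + t * ‖U‖ ^ 2 := by
    rw [← Complex.normSq_eq_norm_sq, Complex.normSq_apply]
    simp
    ring
  have e2 : ((μ * V + p * (U - 2 * V) - (G₁ + t * Complex.I * V)) * conj V).im =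
      -(p * (V * conj U).im) - (G₁ * conj V).im - t * ‖V‖ ^ 2 := by
    rw [← Complex.normSq_eq_norm_sq, Complex.normSq_apply]
    simp
    ring
  have h1 := neg_le_of_abs_le (abs_im_mul_conj_le V U)
  have h2 := neg_le_of_abs_le (abs_im_mul_conj_le G₀ U)
  have h3 := neg_le_of_abs_le (abs_im_mul_conj_le G₁ V)
  have h4 := mul_le_div_add_mul ht0 ‖G₀‖ ‖U‖
  have h5 := mul_le_div_add_mul ht0 ‖G₁‖ ‖V‖
  have h6 : p * (‖V‖ * ‖U‖) ≤ t / 4 * (‖V‖ * ‖U‖) :=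
    mul_le_mul_of_nonneg_right (by linarith) (by positivity)
  have h7 : p * -(‖V‖ * ‖U‖) ≤ p * (V * conj U).im := mul_le_mul_of_nonneg_left h1 hp
  have h8 : t / 4 * (2 * (‖V‖ * ‖U‖)) ≤ t / 4 * (‖U‖ ^ 2 + ‖V‖ ^ 2) :=
    mul_le_mul_of_nonneg_left (by nlinarith [sq_nonneg (‖U‖ - ‖V‖)]) (by linarith)
  rw [e1, e2, add_div]
  linarith

/-- Pointwise form of the real part of the energy identity for `(M - i t) W = G`. -/
theorem re_energy_density_ge {μ p Φ t : ℝ} (hp : 0 ≤ p) (hpΦ : p ≤ Φ) (ht : 4 * Φ ≤ t)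
    (ht0 : 0 < t) (U V G₀ G₁ : ℂ) (hμ : 0 ≤ μ) :
    -(t * (‖U‖ ^ 2 + ‖V‖ ^ 2) + (‖G₀‖ ^ 2 + ‖G₁‖ ^ 2) / t) ≤
      ((μ * U - p * (2 * U - V) + (G₀ + t * Complex.I * U)) * conj U).re +
      ((μ * V + p * (U - 2 * V) - (G₁ + t * Complex.I * V)) * conj V).re := by
  have e1 : ((μ * U - p * (2 * U - V) + (G₀ + t * Complex.I * U)) * conj U).re =
      μ * ‖U‖ ^ 2 - 2 * (p * ‖U‖ ^ 2) + p * (V * conj U).re + (G₀ * conj U).re := by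
    rw [← Complex.normSq_eq_norm_sq, Complex.normSq_apply]
    simp
    ring
  have e2 : ((μ * V + p * (U - 2 * V) - (G₁ + t * Complex.I * V)) * conj V).re =
      μ * ‖V‖ ^ 2 - 2 * (p * ‖V‖ ^ 2) + p * (V * conj U).re - (G₁ * conj V).re := by
    rw [← Complex.normSq_eq_norm_sq, Complex.normSq_apply]
    simp
    ring
  have h1 := neg_le_of_abs_le (abs_re_mul_conj_le V U)
  have h2 := neg_le_of_abs_le (abs_re_mul_conj_le G₀ U)
  have h3 := le_of_abs_le (abs_re_mul_conj_le G₁ V)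
  have h4 := mul_le_div_add_mul ht0 ‖G₀‖ ‖U‖
  have h5 := mul_le_div_add_mul ht0 ‖G₁‖ ‖V‖
  have h7 : p * -(‖V‖ * ‖U‖) ≤ p * (V * conj U).re := mul_le_mul_of_nonneg_left h1 hp
  have h6 : p * (2 * (‖V‖ * ‖U‖)) ≤ p * (‖U‖ ^ 2 + ‖V‖ ^ 2) :=
    mul_le_mul_of_nonneg_left (by nlinarith [sq_nonneg (‖U‖ - ‖V‖)]) hp
  have h8 : p * (‖U‖ ^ 2 + ‖V‖ ^ 2) ≤ t / 4 * (‖U‖ ^ 2 + ‖V‖ ^ 2) :=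
    mul_le_mul_of_nonneg_right (by linarith) (by positivity)
  have h9 : 0 ≤ μ * ‖U‖ ^ 2 := by positivity
  have h10 : 0 ≤ μ * ‖V‖ ^ 2 := by positivity
  rw [e1, e2, add_div]
  linarith

/-- Resolvent estimate for `M` at the point `i s²`, from `L²` to the supremum norm: if
`(M - i s²) W = G` then `|W|² ≤ 5 s⁻³ ‖G‖²` componentwise, as soon as `s²` dominates `φ²`. The
imaginary part of the energy identity controls `‖W‖`, its real part controls `‖W'‖`, and the Sobolev
inequality at scale `s` combines the two. -/
theorem ClassicalM.resolvent_estimate {μ Φ s : ℝ} {φ : ℝ → ℝ} (hμ : 0 ≤ μ)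
    (hΦ : ∀ x ∈ Icc (0 : ℝ) 1, φ x ^ 2 ≤ Φ) (hs : 0 < s) (hsΦ : 4 * Φ ≤ s ^ 2)
    {W G : ℝ → EuclideanSpace ℂ (Fin 2)} (hG : ContinuousOn G (Icc 0 1))
    (hW : ClassicalM μ φ W (G + ((s ^ 2 : ℝ) * Complex.I : ℂ) • W)) {x : ℝ}
    (hx : x ∈ Icc (0 : ℝ) 1) (i : Fin 2) :
    ‖W x i‖ ^ 2 ≤ 5 / s ^ 3 * ∫ y in (0 : ℝ)..1, ‖G y‖ ^ 2 := by
  obtain ⟨⟨u', v', hu, hv⟩, -⟩ := hW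
  set t := s ^ 2 with ht
  have ht0 : 0 < t := by positivity
  have hcu := hu.cont
  have hcv := hv.cont
  have hcu' := hu.cont'
  have hcv' := hv.cont'
  have hX : ContinuousOn (fun y => ‖W y 0‖ ^ 2 + ‖W y 1‖ ^ 2) (Icc 0 1) := by fun_prop
  have hZ : ContinuousOn (fun y => ‖G y 0‖ ^ 2 + ‖G y 1‖ ^ 2) (Icc 0 1) := by fun_prop
  have eX : ∫ y in (0 : ℝ)..1, (‖W y 0‖ ^ 2 + ‖W y 1‖ ^ 2) =
      (∫ y in (0 : ℝ)..1, ‖W y 0‖ ^ 2) + ∫ y in (0 : ℝ)..1, ‖W y 1‖ ^ 2 := by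
    apply intervalIntegral.integral_add <;>
    exact ContinuousOn.intervalIntegrable_of_Icc zero_le_one (by fun_prop)
  have eZ : ∫ y in (0 : ℝ)..1, ‖G y‖ ^ 2 =
      ∫ y in (0 : ℝ)..1, (‖G y 0‖ ^ 2 + ‖G y 1‖ ^ 2) := by
    simp [EuclideanSpace.norm_sq_eq]
  rw [eZ]
  set X := ∫ y in (0 : ℝ)..1, (‖W y 0‖ ^ 2 + ‖W y 1‖ ^ 2)
  set Z := ∫ y in (0 : ℝ)..1, (‖G y 0‖ ^ 2 + ‖G y 1‖ ^ 2)
  have ixX := hX.intervalIntegrable_of_Icc (μ := volume) zero_le_one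
  have ixZ := hZ.intervalIntegrable_of_Icc (μ := volume) zero_le_one
  have him : t / 2 * X - Z / t ≤ 0 := by
    have h := integral_le_of_continuousOn (f := fun y => t / 2 * (‖W y 0‖ ^ 2 + ‖W y 1‖ ^ 2) -
      (‖G y 0‖ ^ 2 + ‖G y 1‖ ^ 2) / t) ((continuousOn_const.mul hX).sub (hZ.div_const t))
      (hu.continuousOn_im_mul_conj.sub hv.continuousOn_im_mul_conj) (fun y hy => by
        have := im_energy_density_ge (μ := μ) (sq_nonneg (φ y)) (hΦ y hy) hsΦ ht0 (W y 0)
          (W y 1) (G y 0) (G y 1)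
        simpa using this)
    rw [intervalIntegral.integral_sub (ixX.const_mul _) (ixZ.div_const _),
      intervalIntegral.integral_const_mul, intervalIntegral.integral_div] at h
    exact h.trans_eq (hu.integral_im_sub_im hv)
  have hre : (∫ y in (0 : ℝ)..1, ‖u' y‖ ^ 2) + (∫ y in (0 : ℝ)..1, ‖v' y‖ ^ 2) ≤
      t * X + Z / t := by
    have h := integral_le_of_continuousOn (f := fun y => -(t * (‖W y 0‖ ^ 2 + ‖W y 1‖ ^ 2) +
      (‖G y 0‖ ^ 2 + ‖G y 1‖ ^ 2) / t)) ((continuousOn_const.mul hX).add (hZ.div_const t)).neg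
      (hu.continuousOn_re_mul_conj.add hv.continuousOn_re_mul_conj) (fun y hy => by
        have := re_energy_density_ge (sq_nonneg (φ y)) (hΦ y hy) hsΦ ht0 (W y 0)
          (W y 1) (G y 0) (G y 1) hμ
        simpa using this)
    rw [intervalIntegral.integral_neg, intervalIntegral.integral_add (ixX.const_mul _)
      (ixZ.div_const _), intervalIntegral.integral_const_mul, intervalIntegral.integral_div] at h
    exact neg_le_neg_iff.1 (h.trans_eq (hu.integral_re_add_re hv))
  have n1 : 0 ≤ ∫ y in (0 : ℝ)..1, ‖W y 0‖ ^ 2 :=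
    intervalIntegral.integral_nonneg zero_le_one fun _ _ => by positivity
  have n2 : 0 ≤ ∫ y in (0 : ℝ)..1, ‖W y 1‖ ^ 2 :=
    intervalIntegral.integral_nonneg zero_le_one fun _ _ => by positivity
  have n3 : 0 ≤ ∫ y in (0 : ℝ)..1, ‖u' y‖ ^ 2 :=
    intervalIntegral.integral_nonneg zero_le_one fun _ _ => by positivity
  have n4 : 0 ≤ ∫ y in (0 : ℝ)..1, ‖v' y‖ ^ 2 :=
    intervalIntegral.integral_nonneg zero_le_one fun _ _ => by positivity
  have key : ‖W x i‖ ^ 2 ≤ s * X + s⁻¹ * (t * X + Z / t) := by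
    have hs' : 0 < s⁻¹ := by positivity
    fin_cases i
    · have := hu.norm_sq_le hs hx
      refine this.trans (add_le_add ?_ ?_)
      · exact mul_le_mul_of_nonneg_left (by linarith) hs.le
      · exact mul_le_mul_of_nonneg_left (by linarith) hs'.le
    · have := hv.norm_sq_le hs hx
      refine this.trans (add_le_add ?_ ?_)
      · exact mul_le_mul_of_nonneg_left (by linarith) hs.le
      · exact mul_le_mul_of_nonneg_left (by linarith) hs'.le
  have hXle : X ≤ 2 * Z / t ^ 2 := by
    rw [le_div_iff₀ (by positivity)]
    have : t / 2 * X ≤ Z / t := by linarith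
    rw [le_div_iff₀ ht0] at this
    nlinarith
  have e : s * X + s⁻¹ * (t * X + Z / t) = 2 * s * X + Z / s ^ 3 := by
    rw [ht]
    field_simp
    ring
  have e' : 2 * s * (2 * Z / t ^ 2) + Z / s ^ 3 = 5 / s ^ 3 * Z := by
    rw [ht]
    field_simp
    ring
  calc ‖W x i‖ ^ 2 ≤ 2 * s * X + Z / s ^ 3 := key.trans e.le
    _ ≤ 2 * s * (2 * Z / t ^ 2) + Z / s ^ 3 := by gcongr
    _ = _ := e'

/-! ### Counting eigenvalues by a trace estimate -/

/-- If `T` maps the unit ball of a finite-dimensional space of functions, with the `L²` norm, to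
functions with values bounded by `√K`, then `∑ |T e_j (x)|² ≤ K` for every orthonormal basis, by
duality; integrating in `x` bounds the Hilbert–Schmidt norm of `T`, hence its trace. -/
theorem norm_trace_sq_le {S : Type*} [NormedAddCommGroup S] [InnerProductSpace ℂ S]
    [FiniteDimensional ℂ S] (T : S →ₗ[ℂ] S) (ev : S →ₗ[ℂ] (ℝ → EuclideanSpace ℂ (Fin 2)))
    {K : ℝ} (hK : 0 ≤ K) (hc : ∀ f, ContinuousOn (ev f) (Icc 0 1))
    (hn : ∀ f, ‖f‖ ^ 2 = ∫ x in (0 : ℝ)..1, ‖ev f x‖ ^ 2)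
    (hT : ∀ f, ∀ x ∈ Icc (0 : ℝ) 1, ∀ i, ‖ev (T f) x i‖ ^ 2 ≤ K * ‖f‖ ^ 2) :
    ‖LinearMap.trace ℂ S T‖ ^ 2 ≤ 2 * K * Module.finrank ℂ S := by
  set e := stdOrthonormalBasis ℂ S
  have hpt : ∀ x ∈ Icc (0 : ℝ) 1, ∀ i, ∑ j, ‖ev (T (e j)) x i‖ ^ 2 ≤ K := by
    intro x hx i
    set A := ∑ j, ‖ev (T (e j)) x i‖ ^ 2 with hA
    -- The combination of the `e j` for which evaluating `T f` at `x` is extremal.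
    set f := ∑ j, conj (ev (T (e j)) x i) • e j with hf
    have h1 : ‖f‖ ^ 2 = A := by
      rw [hf, @norm_sq_eq_re_inner ℂ, e.orthonormal.inner_sum]
      simp [hA, ← Complex.normSq_eq_norm_sq, Complex.normSq_apply]
    have h2 : ev (T f) x i = (A : ℂ) := by
      simp only [hf, map_sum, map_smul, Finset.sum_apply, Pi.smul_apply, WithLp.ofLp_sum,
        PiLp.smul_apply, smul_eq_mul, hA, Complex.ofReal_sum]
      refine Finset.sum_congr rfl fun j _ => ?_
      rw [← Complex.normSq_eq_norm_sq, ← Complex.mul_conj, mul_comm]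
    have h3 := hT f x hx i
    have hA0 : 0 ≤ A := Finset.sum_nonneg fun _ _ => by positivity
    rw [h2, h1, Complex.norm_real, Real.norm_of_nonneg hA0] at h3
    rcases hA0.eq_or_lt with h | h
    · rwa [← h]
    · exact le_of_mul_le_mul_right (by linarith [sq A]) h
  have hHS : ∑ j, ‖T (e j)‖ ^ 2 ≤ 2 * K := by
    simp only [hn]
    have hcj : ∀ j, ContinuousOn (fun x => ‖ev (T (e j)) x‖ ^ 2) (Icc 0 1) := fun j =>
      (hc _).norm.pow 2
    rw [← intervalIntegral.integral_finsetSum fun j _ =>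
      (hcj j).intervalIntegrable_of_Icc zero_le_one]
    refine (integral_le_of_continuousOn (continuousOn_finsetSum _ fun j _ => hcj j)
      (g := fun _ => 2 * K) continuousOn_const fun x hx => ?_).trans (by simp)
    simp only [EuclideanSpace.norm_sq_eq, Fin.sum_univ_two, Finset.sum_add_distrib]
    linarith [hpt x hx 0, hpt x hx 1]
  have htr : ‖LinearMap.trace ℂ S T‖ ≤ ∑ j, ‖T (e j)‖ := by
    rw [LinearMap.trace_eq_sum_inner T e]
    refine (norm_sum_le _ _).trans (Finset.sum_le_sum fun j _ => ?_)
    refine (norm_inner_le_norm _ _).trans ?_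
    rw [e.norm_eq_one, one_mul]
  calc ‖LinearMap.trace ℂ S T‖ ^ 2 ≤ (∑ j, ‖T (e j)‖) ^ 2 := by gcongr
    _ ≤ Module.finrank ℂ S * ∑ j, ‖T (e j)‖ ^ 2 := by
      simpa using sq_sum_le_card_mul_sum_sq (s := Finset.univ) (f := fun j => ‖T (e j)‖)
    _ ≤ Module.finrank ℂ S * (2 * K) := by gcongr
    _ = _ := by ring

/-- Functions `ℝ → ℂ²` which are continuous on `[0,1]` and vanish outside. -/
def continuousOnUnit : Submodule ℂ (ℝ → EuclideanSpace ℂ (Fin 2)) where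
  carrier := {W | ContinuousOn W (Icc 0 1) ∧ ∀ x, x ∉ Icc (0 : ℝ) 1 → W x = 0}
  zero_mem' := ⟨continuousOn_const, fun _ _ => rfl⟩
  add_mem' := fun hW hZ => ⟨hW.1.add hZ.1, fun x hx => by simp [hW.2 x hx, hZ.2 x hx]⟩
  smul_mem' := fun c _ hW => ⟨hW.1.const_smul c, fun x hx => by simp [hW.2 x hx]⟩

theorem memLp_of_mem_continuousOnUnit (W : continuousOnUnit) :
    MemLp (W : ℝ → EuclideanSpace ℂ (Fin 2)) 2 (volume.restrict (Icc (0 : ℝ) 1)) := by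
  have h := W.2.1
  obtain ⟨C, hC⟩ := isCompact_Icc.exists_bound_of_continuousOn h
  exact MemLp.of_bound (h.aestronglyMeasurable measurableSet_Icc) C
    ((ae_restrict_iff' measurableSet_Icc).2 (Filter.Eventually.of_forall hC))

/-- The embedding of `continuousOnUnit` into `L²((0,1); ℂ²)`. -/
noncomputable def continuousOnUnitToL2 :
    continuousOnUnit →ₗ[ℂ] Lp (EuclideanSpace ℂ (Fin 2)) 2 (volume.restrict (Icc (0 : ℝ) 1)) where
  toFun W := (memLp_of_mem_continuousOnUnit W).toLp _
  map_add' _ _ := rfl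
  map_smul' _ _ := rfl

theorem continuousOnUnitToL2_injective : Function.Injective continuousOnUnitToL2 := by
  rw [← LinearMap.ker_eq_bot, LinearMap.ker_eq_bot']
  intro W hW
  have h1 := (memLp_of_mem_continuousOnUnit W).coeFn_toLp
  have h2 : (memLp_of_mem_continuousOnUnit W).toLp _ = 0 := hW
  rw [h2] at h1
  have h3 : (W : ℝ → EuclideanSpace ℂ (Fin 2)) =ᵐ[volume.restrict (Icc (0 : ℝ) 1)] 0 :=
    h1.symm.trans (Lp.coeFn_zero _ _ _)
  have h4 := Measure.eqOn_Icc_of_ae_eq _ zero_ne_one h3 W.2.1 continuousOn_const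
  ext1
  exact eq_zero_of_eqOn_Ioo W.2.1 W.2.2 fun x hx => h4 (Ioo_subset_Icc_self hx)

theorem norm_continuousOnUnitToL2_sq (W : continuousOnUnit) :
    ‖continuousOnUnitToL2 W‖ ^ 2 =
      ∫ x in (0 : ℝ)..1, ‖(W : ℝ → EuclideanSpace ℂ (Fin 2)) x‖ ^ 2 := by
  rw [intervalIntegral.integral_of_le zero_le_one, ← integral_Icc_eq_integral_Ioc]
  have h1 := L2.inner_def (𝕜 := ℂ) (continuousOnUnitToL2 W) (continuousOnUnitToL2 W)
  have h2 : ∫ a, ⟪continuousOnUnitToL2 W a, continuousOnUnitToL2 W a⟫_ℂ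
        ∂(volume.restrict (Icc (0 : ℝ) 1)) =
      ∫ x, ((‖(W : ℝ → EuclideanSpace ℂ (Fin 2)) x‖ ^ 2 : ℝ) : ℂ)
        ∂(volume.restrict (Icc (0 : ℝ) 1)) := by
    refine integral_congr_ae ?_
    filter_upwards [(memLp_of_mem_continuousOnUnit W).coeFn_toLp] with x hx
    have : continuousOnUnitToL2 W x = (W : ℝ → EuclideanSpace ℂ (Fin 2)) x := hx
    rw [this, inner_self_eq_norm_sq_to_K]
    simp
  rw [h2, integral_complex_ofReal, inner_self_eq_norm_sq_to_K] at h1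
  refine Complex.ofReal_injective (Eq.trans ?_ h1)
  simp

theorem one_div_two_mul_le_im_inv {b s : ℝ} (hs : 0 < s) (hb0 : 0 ≤ b) (hb : b ≤ s ^ 2) :
    1 / (2 * s ^ 2) ≤ (((b : ℂ) - ((s ^ 2 : ℝ) : ℂ) * Complex.I)⁻¹).im := by
  have h1 : (((b : ℂ) - ((s ^ 2 : ℝ) : ℂ) * Complex.I)⁻¹).im =
      s ^ 2 / (b * b + s ^ 2 * s ^ 2) := by
    rw [Complex.inv_im, Complex.normSq_apply]
    simp [-Complex.ofReal_pow]
  rw [h1, div_le_div_iff₀ (by positivity) (by positivity)]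
  nlinarith [mul_le_mul hb hb hb0 (by positivity)]

/-- The number of linearly independent eigenfunctions of `M` with eigenvalues in `[0, s²]` is at
most `40 s`. The trace of the resolvent at `i s²` on the span of these eigenfunctions has imaginary
part at least `N / (2 s²)`, while the resolvent estimate bounds its square by `10 N / s³`. -/
theorem card_le_of_linearIndependent_eigenspaceM {μ Φ s : ℝ} {φ : ℝ → ℝ} (hμ : 0 ≤ μ)
    (hφ : ContinuousOn φ (Icc 0 1)) (hΦ : ∀ x ∈ Icc (0 : ℝ) 1, φ x ^ 2 ≤ Φ) (hs : 0 < s)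
    (hsΦ : 4 * Φ ≤ s ^ 2) {N : ℕ} {b : Fin N → ℝ} {W : Fin N → ℝ → EuclideanSpace ℂ (Fin 2)}
    (hW : ∀ i, W i ∈ eigenspaceM μ φ (b i : ℂ)) (hli : LinearIndependent ℂ W)
    (hb0 : ∀ i, 0 ≤ b i) (hb : ∀ i, b i ≤ s ^ 2) : (N : ℝ) ≤ 40 * s := by
  have hcl : ∀ i, ClassicalM μ φ (W i) ((b i : ℂ) • W i) := fun i =>
    classicalM_of_mem_eigenspaceM hφ (hW i)
  let Wc : Fin N → continuousOnUnit := fun i => ⟨W i, (hcl i).continuousOn, (hcl i).2⟩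
  have hlic : LinearIndependent ℂ Wc := LinearIndependent.of_comp continuousOnUnit.subtype hli
  have hliw : LinearIndependent ℂ (continuousOnUnitToL2 ∘ Wc) :=
    hlic.map' _ (LinearMap.ker_eq_bot.2 continuousOnUnitToL2_injective)
  let S := Submodule.span ℂ (range (continuousOnUnitToL2 ∘ Wc))
  let B : Module.Basis (Fin N) ℂ S := Module.Basis.span hliw
  have : FiniteDimensional ℂ S := Module.Finite.of_basis B
  -- `ev` recovers the continuous function from its class, and `T` is the resolvent at `i s²`.
  let ev : S →ₗ[ℂ] continuousOnUnit := B.constr ℂ Wc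
  let r : Fin N → ℂ := fun i => ((b i : ℂ) - ((s ^ 2 : ℝ) : ℂ) * Complex.I)⁻¹
  let T : S →ₗ[ℂ] S := B.constr ℂ fun i => r i • B i
  have hev : ∀ f : S, continuousOnUnitToL2 (ev f) = f := by
    have : continuousOnUnitToL2 ∘ₗ ev = S.subtype := B.ext fun i => by
      simp only [LinearMap.comp_apply, ev, Module.Basis.constr_basis, Submodule.subtype_apply]
      exact congrArg Subtype.val (Module.Basis.span_apply hliw i).symm
    exact fun f => LinearMap.congr_fun this f
  have hTr : LinearMap.trace ℂ S T = ∑ i, r i := by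
    rw [LinearMap.trace_eq_matrix_trace ℂ B T, Matrix.trace]
    refine Finset.sum_congr rfl fun i _ => ?_
    simp [Matrix.diag_apply, LinearMap.toMatrix_apply, T]
  have hr : ∀ i, (b i : ℂ) * r i = 1 + ((s ^ 2 : ℝ) : ℂ) * Complex.I * r i := by
    intro i
    have hne : (b i : ℂ) - ((s ^ 2 : ℝ) : ℂ) * Complex.I ≠ 0 := by
      intro h
      have := congrArg Complex.im h
      simp [-Complex.ofReal_pow] at this
      exact hs.ne' this
    have := mul_inv_cancel₀ hne
    simp only [r]
    linear_combination this
  have hres : ∀ f : S, ClassicalM μ φ (ev (T f))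
      ((ev f : ℝ → EuclideanSpace ℂ (Fin 2)) +
        (((s ^ 2 : ℝ) : ℂ) * Complex.I) • (ev (T f) : ℝ → EuclideanSpace ℂ (Fin 2))) := by
    intro f
    have h1 : (ev f : ℝ → EuclideanSpace ℂ (Fin 2)) = ∑ i, B.repr f i • W i := by
      conv_lhs => rw [← B.sum_repr f]
      simp [ev, Wc]
    have h2 : (ev (T f) : ℝ → EuclideanSpace ℂ (Fin 2)) = ∑ i, (B.repr f i * r i) • W i := by
      conv_lhs => rw [← B.sum_repr f]
      simp [ev, T, Wc, smul_smul]
    have h3 := ClassicalM.sum Finset.univ fun i _ => (hcl i).smul (B.repr f i * r i)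
    rw [h2, h1]
    convert h3 using 1
    rw [Finset.smul_sum, ← Finset.sum_add_distrib]
    refine Finset.sum_congr rfl fun i _ => ?_
    rw [smul_smul, smul_smul, ← add_smul]
    congr 1
    linear_combination -(B.repr f i) * hr i
  have hmain := norm_trace_sq_le T (continuousOnUnit.subtype ∘ₗ ev) (K := 5 / s ^ 3)
    (by positivity) (fun f => (ev f).2.1)
    (fun f => by
      have := norm_continuousOnUnitToL2_sq (ev f)
      rw [hev] at this
      exact this)
    (fun f x hx i => by
      have h := (hres f).resolvent_estimate hμ hΦ hs hsΦ (ev f).2.1 hx i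
      rw [← norm_continuousOnUnitToL2_sq, hev] at h
      exact h)
  rw [hTr, Module.finrank_eq_card_basis B, Fintype.card_fin] at hmain
  have hlow : (N : ℝ) * (1 / (2 * s ^ 2)) ≤ ‖∑ i, r i‖ := by
    refine le_trans ?_ (Complex.abs_im_le_norm _)
    refine le_trans ?_ (le_abs_self _)
    rw [Complex.im_sum]
    have := Finset.card_nsmul_le_sum Finset.univ (fun i => (r i).im) (1 / (2 * s ^ 2))
      fun i _ => one_div_two_mul_le_im_inv hs (hb0 i) (hb i)
    simpa using this
  have h2 : ((N : ℝ) * (1 / (2 * s ^ 2))) ^ 2 ≤ 2 * (5 / s ^ 3) * N :=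
    le_trans (by gcongr) hmain
  have h3 : ((N : ℝ) * (1 / (2 * s ^ 2))) ^ 2 = N * (N / (4 * s ^ 4)) := by
    field_simp
    ring
  rw [h3, mul_comm (2 * (5 / s ^ 3))] at h2
  rcases (Nat.cast_nonneg (α := ℝ) N).eq_or_lt with h | h
  · rw [← h]
    positivity
  · have h4 := le_of_mul_le_mul_left h2 h
    rw [div_le_iff₀ (by positivity)] at h4
    have h5 : 2 * (5 / s ^ 3) * (4 * s ^ 4) = 40 * s := by
      field_simp
      ring
    linarith

/-- The eigenvalue list can be matched with a linearly independent sequence of eigenfunctions. -/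
theorem IsPosEigenvalueList.exists_linearIndependent {μ : ℝ} {φ : ℝ → ℝ} {β : ℕ → ℝ}
    (hφ : ContinuousOn φ (Icc 0 1)) (hβ : IsPosEigenvalueList μ φ β) :
    ∃ W : {n : ℕ // 2 ≤ n} → ℝ → EuclideanSpace ℂ (Fin 2),
      (∀ n : {n : ℕ // 2 ≤ n}, W n ∈ eigenspaceM μ φ (β n : ℂ)) ∧ LinearIndependent ℂ W := by
  classical
  -- Within one eigenvalue, a basis of the eigenspace is distributed over the indices; distinct
  -- eigenvalues are independent.
  have hfib : ∀ b : ℝ, ∃ w : ℕ → ℝ → EuclideanSpace ℂ (Fin 2),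
      0 < b → (∀ n, w n ∈ eigenspaceM μ φ (b : ℂ)) ∧
        LinearIndepOn ℂ w {n : ℕ | 2 ≤ n ∧ β n = b} := by
    intro b
    by_cases hb : 0 < b
    swap
    · exact ⟨fun _ => 0, fun h => absurd h hb⟩
    have hcard := hβ.mult b hb
    set A := {n : ℕ | 2 ≤ n ∧ β n = b} with hA
    rcases A.eq_empty_or_nonempty with h0 | h0
    · refine ⟨fun _ => 0, fun _ => ⟨fun _ => Submodule.zero_mem _, ?_⟩⟩
      rw [h0]
      exact linearIndepOn_empty _ _
    have hfin : A.Finite := Set.finite_of_encard_eq_coe hcard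
    have hnc : A.ncard = Module.finrank ℂ (eigenspaceM μ φ (b : ℂ)) := by
      have := hfin.cast_ncard_eq
      rw [hcard] at this
      exact_mod_cast this
    have hpos : 0 < Module.finrank ℂ (eigenspaceM μ φ (b : ℂ)) := by
      rw [← hnc]
      exact (Set.ncard_pos hfin).2 h0
    have := Module.finite_of_finrank_pos hpos
    have := hfin.fintype
    let e : A ≃ Fin (Module.finrank ℂ (eigenspaceM μ φ (b : ℂ))) :=
      Fintype.equivFinOfCardEq (by rw [← hnc, Set.ncard_eq_toFinset_card', Set.toFinset_card])
    let B := Module.finBasis ℂ (eigenspaceM μ φ (b : ℂ))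
    refine ⟨fun n => if h : n ∈ A then (B (e ⟨n, h⟩) : ℝ → EuclideanSpace ℂ (Fin 2)) else 0,
      fun _ => ⟨fun n => ?_, ?_⟩⟩
    · dsimp only
      split_ifs
      · exact Submodule.coe_mem _
      · exact Submodule.zero_mem _
    · have h1 : LinearIndependent ℂ fun i : A =>
          (B (e i) : ℝ → EuclideanSpace ℂ (Fin 2)) :=
        (B.linearIndependent.comp e e.injective).map' (eigenspaceM μ φ (b : ℂ)).subtype
          (Submodule.ker_subtype _)
      have h2 : (fun i : A => if h : (i : ℕ) ∈ A then
          (B (e ⟨i, h⟩) : ℝ → EuclideanSpace ℂ (Fin 2)) else 0) = fun i : A =>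
          (B (e i) : ℝ → EuclideanSpace ℂ (Fin 2)) := by
        ext1 i
        simp
      rw [← h2] at h1
      exact h1
  choose w hw using hfib
  refine ⟨fun n : {n : ℕ // 2 ≤ n} => w (β n) n, fun n => (hw _ (hβ.pos n n.2)).1 n, ?_⟩
  rw [linearIndependent_iff']
  intro s g hsum
  have h1 : ∀ a ∈ s, β a ∈ s.image fun n : {n : ℕ // 2 ≤ n} => β n := fun a ha =>
    Finset.mem_image_of_mem (fun n : {n : ℕ // 2 ≤ n} => β n) ha
  rw [← Finset.sum_fiberwise_of_maps_to h1] at hsum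
  have h2 := eq_zero_of_sum_eigenspaceM_eq_zero (μ := μ) hφ _
    (fun b => ∑ n ∈ s.filter fun n : {n : ℕ // 2 ≤ n} => β n = b, g n • w (β n) n) (fun b _ => by
      refine Submodule.sum_mem _ fun n hn => Submodule.smul_mem _ _ ?_
      have h3 := (Finset.mem_filter.1 hn).2
      rw [← h3]
      exact (hw _ (hβ.pos n n.2)).1 n) hsum
  intro i hi
  have h4 := h2 (β i) (h1 i hi)
  have h5 := (hw _ (hβ.pos i i.2)).2
  rw [linearIndepOn_iff'] at h5
  have h6 := h5 ((s.filter fun n : {n : ℕ // 2 ≤ n} => β n = β i).map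
      ⟨Subtype.val, Subtype.val_injective⟩)
    (fun n => if h : 2 ≤ n then g ⟨n, h⟩ else 0)
    (by
      intro n hn
      simp only [Finset.coe_map, Function.Embedding.coeFn_mk, mem_image] at hn
      obtain ⟨m, hm, rfl⟩ := hn
      exact ⟨m.2, (Finset.mem_filter.1 hm).2⟩)
    (by
      rw [Finset.sum_map, ← h4]
      refine Finset.sum_congr rfl fun n hn => ?_
      simp [n.2, (Finset.mem_filter.1 hn).2])
    i (by simp [hi])
  simpa [i.2] using h6

/-- At most `40 s` of the eigenvalues `β 2, β 3, …` are bounded by `s²`; the shift by one comes from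
the list starting at index `2`. -/
theorem IsPosEigenvalueList.sub_one_le {μ Φ s : ℝ} {φ : ℝ → ℝ} {β : ℕ → ℝ} (hμ : 0 ≤ μ)
    (hφ : ContinuousOn φ (Icc 0 1)) (hΦ : ∀ x ∈ Icc (0 : ℝ) 1, φ x ^ 2 ≤ Φ)
    (hβ : IsPosEigenvalueList μ φ β) (hs : 0 < s) (hsΦ : 4 * Φ ≤ s ^ 2) {n : ℕ} (hn : 2 ≤ n)
    (hβs : β n ≤ s ^ 2) : (n : ℝ) - 1 ≤ 40 * s := by
  obtain ⟨W, hW, hli⟩ := hβ.exists_linearIndependent hφ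
  let ι : Fin (n - 1) → {n : ℕ // 2 ≤ n} := fun i => ⟨i + 2, by omega⟩
  have hι : Function.Injective ι := fun i j h => by
    have := congrArg Subtype.val h
    simp only [ι] at this
    exact Fin.ext (by omega)
  have h := card_le_of_linearIndependent_eigenspaceM hμ hφ hΦ hs hsΦ
    (b := fun i => β (ι i)) (fun i => hW (ι i)) (hli.comp ι hι)
    (fun i => (hβ.pos _ (ι i).2).le) fun i => (hβ.mono _ n (ι i).2 (by
      have := i.2
      simp only [ι]
      omega)).trans hβs
  rw [Nat.cast_sub (by omega)] at h
  simpa using h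

/-! ### Asymptotics of the eigenfunctions -/

/-- Variation of constants for `v'' = -k² v + h`, `v 0 = 0`, in differentiated form: the quantity
`v' (t) sin (k (x - t)) + k v (t) cos (k (x - t))` has `t`-derivative `h (t) sin (k (x - t))`. -/
theorem IsC2Dirichlet.norm_mul_sub_sin_le {v v' h : ℝ → ℂ} {k H : ℝ}
    (hv : IsC2Dirichlet v v' fun x => -(k : ℂ) ^ 2 * v x + h x)
    (hH : ∀ x ∈ Icc (0 : ℝ) 1, ‖h x‖ ≤ H) {x : ℝ} (hx : x ∈ Icc (0 : ℝ) 1) :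
    ‖(k : ℂ) * v x - v' 0 * (Real.sin (k * x) : ℂ)‖ ≤ H := by
  have hH0 : 0 ≤ H := (norm_nonneg _).trans (hH 0 (by simp))
  have hsub : Icc 0 x ⊆ Icc 0 1 := Icc_subset_Icc_right hx.2
  have hcv := hv.cont
  have hcv' := hv.cont'
  have hch : ContinuousOn h (Icc 0 1) := by
    have : ContinuousOn (fun x => (-(k : ℂ) ^ 2 * v x + h x) + (k : ℂ) ^ 2 * v x) (Icc 0 1) :=
      hv.cont''.add (continuousOn_const.mul hcv)
    refine this.congr fun y _ => ?_
    ring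
  have hS : Continuous fun t : ℝ => (Real.sin (k * (x - t)) : ℂ) :=
    Complex.continuous_ofReal.comp (by fun_prop)
  have hC : Continuous fun t : ℝ => (Real.cos (k * (x - t)) : ℂ) :=
    Complex.continuous_ofReal.comp (by fun_prop)
  have key : ∫ t in (0 : ℝ)..x, h t * (Real.sin (k * (x - t)) : ℂ) =
      (v' x * (Real.sin (k * (x - x)) : ℂ) + k * v x * (Real.cos (k * (x - x)) : ℂ)) -
      (v' 0 * (Real.sin (k * (x - 0)) : ℂ) + k * v 0 * (Real.cos (k * (x - 0)) : ℂ)) := by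
    refine intervalIntegral.integral_eq_sub_of_hasDerivAt_of_le (f := fun t =>
      v' t * (Real.sin (k * (x - t)) : ℂ) + k * v t * (Real.cos (k * (x - t)) : ℂ)) hx.1 ?_ ?_ ?_
    · exact (((hcv'.mul hS.continuousOn).add
        ((continuousOn_const.mul hcv).mul hC.continuousOn))).mono hsub
    · intro t ht
      have ht' : t ∈ Ioo (0 : ℝ) 1 := ⟨ht.1, ht.2.trans_le hx.2⟩
      have h0 : HasDerivAt (fun t : ℝ => k * (x - t)) (-k) t := by
        simpa using ((hasDerivAt_id t).const_sub x).const_mul k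
      have h1 := (hv.hasDerivAt' t ht').mul h0.sin.ofReal_comp
      have h2 := ((hv.hasDerivAt t ht').const_mul (k : ℂ)).mul h0.cos.ofReal_comp
      refine (h1.add h2).congr_deriv ?_
      push_cast
      ring
    · exact ((hch.mul hS.continuousOn).mono hsub).intervalIntegrable_of_Icc hx.1
  have e : (k : ℂ) * v x - v' 0 * (Real.sin (k * x) : ℂ) =
      ∫ t in (0 : ℝ)..x, h t * (Real.sin (k * (x - t)) : ℂ) := by
    rw [key, hv.left]
    simp
  rw [e]
  refine (intervalIntegral.norm_integral_le_of_norm_le_const (C := H) fun t ht => ?_).trans ?_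
  · rw [uIoc_of_le hx.1] at ht
    rw [norm_mul, Complex.norm_real, Real.norm_eq_abs]
    calc ‖h t‖ * |Real.sin (k * (x - t))| ≤ H * 1 :=
          mul_le_mul (hH t ⟨ht.1.le, ht.2.trans hx.2⟩) (Real.abs_sin_le_one _) (abs_nonneg _) hH0
      _ = H := mul_one H
  · rw [sub_zero, abs_of_nonneg hx.1]
    exact mul_le_of_le_one_right hH0 hx.2

/-- Energy estimate for `u'' = κ² u + h` with Dirichlet conditions. -/
theorem IsC2Dirichlet.norm_le_div {u u' h : ℝ → ℂ} {κ H : ℝ} (hκ : 1 ≤ κ)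
    (hu : IsC2Dirichlet u u' fun x => (κ : ℂ) ^ 2 * u x + h x)
    (hH : ∀ x ∈ Icc (0 : ℝ) 1, ‖h x‖ ≤ H) {x : ℝ} (hx : x ∈ Icc (0 : ℝ) 1) :
    ‖u x‖ ≤ H / κ := by
  have hκ0 : 0 < κ := by linarith
  have hH0 : 0 ≤ H := (norm_nonneg _).trans (hH 0 (by simp))
  have hc := hu.cont
  have hX : ContinuousOn (fun y => κ ^ 2 / 2 * ‖u y‖ ^ 2) (Icc 0 1) := by fun_prop
  have h1 : ∫ y in (0 : ℝ)..1, (κ ^ 2 / 2 * ‖u y‖ ^ 2 - H ^ 2 / (2 * κ ^ 2)) ≤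
      -∫ y in (0 : ℝ)..1, ‖u' y‖ ^ 2 := by
    rw [← hu.integral_re_mul_conj]
    refine integral_le_of_continuousOn (hX.sub continuousOn_const)
      hu.continuousOn_re_mul_conj fun y hy => ?_
    have e1 : (((κ : ℂ) ^ 2 * u y + h y) * conj (u y)).re =
        κ ^ 2 * ‖u y‖ ^ 2 + (h y * conj (u y)).re := by
      rw [← Complex.normSq_eq_norm_sq, Complex.normSq_apply, ← Complex.ofReal_pow]
      simp [-Complex.ofReal_pow]
      ring
    have h2 := neg_le_of_abs_le (abs_re_mul_conj_le (h y) (u y))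
    have h3 : ‖h y‖ * ‖u y‖ ≤ H * ‖u y‖ := by
      gcongr
      exact hH y hy
    have h4 := mul_le_div_add_mul (t := 2 * κ ^ 2) (by positivity) H ‖u y‖
    rw [e1]
    linarith
  rw [intervalIntegral.integral_sub (hX.intervalIntegrable_of_Icc zero_le_one)
    intervalIntegrable_const, intervalIntegral.integral_const_mul,
    intervalIntegral.integral_const] at h1
  simp only [sub_zero, one_smul] at h1
  have n1 : 0 ≤ ∫ y in (0 : ℝ)..1, ‖u' y‖ ^ 2 :=
    intervalIntegral.integral_nonneg zero_le_one fun _ _ => by positivity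
  have h2 := hu.norm_sq_le hκ0 hx
  set X := ∫ y in (0 : ℝ)..1, ‖u y‖ ^ 2
  set Y := ∫ y in (0 : ℝ)..1, ‖u' y‖ ^ 2
  have h3 : κ * X + κ⁻¹ * Y = κ⁻¹ * (2 * (κ ^ 2 / 2 * X + Y) - Y) := by
    field_simp
    ring
  have h4 : κ⁻¹ * (2 * (κ ^ 2 / 2 * X + Y) - Y) ≤ 1 * (2 * (H ^ 2 / (2 * κ ^ 2))) := by
    refine mul_le_mul (inv_le_one_of_one_le₀ hκ) (by linarith) ?_ zero_le_one
    have : 0 ≤ X := intervalIntegral.integral_nonneg zero_le_one fun _ _ => by positivity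
    nlinarith [mul_nonneg (sq_nonneg κ) this]
  have h5 : 1 * (2 * (H ^ 2 / (2 * κ ^ 2))) = (H / κ) ^ 2 := by
    field_simp
  refine le_of_sq_le_sq ?_ (by positivity)
  linarith

/-- The coupled system satisfied by an eigenfunction. The component `u`, for which the
equation is elliptic, is `O(1/k)` times the oscillating component `v`, and `v` is a multiple
of `sin (k x)` up to `O(1/k)`. -/
theorem exists_mul_near_sin {u u' v v' p : ℝ → ℂ} {k κ Φ : ℝ} (hk : 1 ≤ k) (hkκ : k ≤ κ)
    (hkΦ : 6 * Φ ≤ k) (hp : ∀ x ∈ Icc (0 : ℝ) 1, ‖p x‖ ≤ Φ)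
    (hu : IsC2Dirichlet u u' fun x => (κ : ℂ) ^ 2 * u x + -(p x * (2 * u x - v x)))
    (hv : IsC2Dirichlet v v' fun x => -(k : ℂ) ^ 2 * v x + p x * (u x - 2 * v x))
    (hne : ∃ x ∈ Icc (0 : ℝ) 1, u x ≠ 0 ∨ v x ≠ 0) :
    ∃ c : ℂ, c ≠ 0 ∧ ∀ x ∈ Icc (0 : ℝ) 1,
      ‖c * u x‖ ≤ 4 * Φ / k ∧ ‖c * v x - (Real.sin (k * x) : ℂ)‖ ≤ 6 * Φ / k := by
  have hk0 : 0 < k := by linarith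
  have hΦ0 : 0 ≤ Φ := (norm_nonneg _).trans (hp 0 (by simp))
  obtain ⟨y, hy, hyU⟩ := isCompact_Icc.exists_isMaxOn (nonempty_Icc.2 zero_le_one) hu.cont.norm
  obtain ⟨z, hz, hzV⟩ := isCompact_Icc.exists_isMaxOn (nonempty_Icc.2 zero_le_one) hv.cont.norm
  set U := ‖u y‖ with hU
  set V := ‖v z‖ with hV
  have hU0 : 0 ≤ U := norm_nonneg _
  have hV0 : 0 ≤ V := norm_nonneg _
  have hUx : ∀ x ∈ Icc (0 : ℝ) 1, ‖u x‖ ≤ U := fun x hx => hyU hx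
  have hVx : ∀ x ∈ Icc (0 : ℝ) 1, ‖v x‖ ≤ V := fun x hx => hzV hx
  have h1 : ∀ x ∈ Icc (0 : ℝ) 1, ‖-(p x * (2 * u x - v x))‖ ≤ Φ * (2 * U + V) := fun x hx => by
    rw [norm_neg, norm_mul]
    refine mul_le_mul (hp x hx) ((norm_sub_le _ _).trans ?_) (norm_nonneg _) hΦ0
    rw [norm_mul, Complex.norm_ofNat]
    linarith [hUx x hx, hVx x hx]
  have h2 : ∀ x ∈ Icc (0 : ℝ) 1, ‖p x * (u x - 2 * v x)‖ ≤ Φ * (U + 2 * V) := fun x hx => by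
    rw [norm_mul]
    refine mul_le_mul (hp x hx) ((norm_sub_le _ _).trans ?_) (norm_nonneg _) hΦ0
    rw [norm_mul, Complex.norm_ofNat]
    linarith [hUx x hx, hVx x hx]
  have h3 : k * U ≤ Φ * (2 * U + V) := by
    have h := hu.norm_le_div (hk.trans hkκ) h1 hy
    rw [le_div_iff₀ (by linarith)] at h
    nlinarith
  have h4 : U ≤ V / 2 := by nlinarith
  have h5 : k * U ≤ 2 * Φ * V := h3.trans (by nlinarith)
  have h6 : Φ * (U + 2 * V) ≤ 3 * Φ * V := by nlinarith
  have h7 : ∀ x ∈ Icc (0 : ℝ) 1, ‖(k : ℂ) * v x - v' 0 * (Real.sin (k * x) : ℂ)‖ ≤ 3 * Φ * V :=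
    fun x hx => (hv.norm_mul_sub_sin_le h2 hx).trans h6
  have h8 : k * V ≤ 2 * ‖v' 0‖ := by
    have h9 := norm_le_norm_add_norm_sub' ((k : ℂ) * v z) (v' 0 * (Real.sin (k * z) : ℂ))
    rw [norm_mul, norm_mul, Complex.norm_real, Complex.norm_real, Real.norm_of_nonneg hk0.le,
      Real.norm_eq_abs] at h9
    have h10 : ‖v' 0‖ * |Real.sin (k * z)| ≤ ‖v' 0‖ :=
      mul_le_of_le_one_right (norm_nonneg _) (Real.abs_sin_le_one _)
    have h11 := h7 z hz
    have h12 : 6 * Φ * V ≤ k * V := mul_le_mul_of_nonneg_right hkΦ hV0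
    linarith
  -- The slope `v' 0` cannot vanish, for otherwise `v` and then `u` would vanish identically.
  have hd : v' 0 ≠ 0 := by
    intro hd
    rw [hd, norm_zero, mul_zero] at h8
    have hV00 : V = 0 := le_antisymm (by nlinarith) hV0
    have hU00 : U = 0 := le_antisymm (by linarith) hU0
    obtain ⟨x, hx, h | h⟩ := hne
    · exact h (norm_le_zero_iff.1 (hU00 ▸ hUx x hx))
    · exact h (norm_le_zero_iff.1 (hV00 ▸ hVx x hx))
  have hd0 : 0 < ‖v' 0‖ := norm_pos_iff.2 hd
  have hkc : (k : ℂ) ≠ 0 := Complex.ofReal_ne_zero.2 hk0.ne'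
  refine ⟨k / v' 0, div_ne_zero hkc hd, fun x hx => ⟨?_, ?_⟩⟩
  · rw [norm_mul, norm_div, Complex.norm_real, Real.norm_of_nonneg hk0.le, div_mul_eq_mul_div,
      div_le_div_iff₀ hd0 hk0]
    calc k * ‖u x‖ * k ≤ k * U * k := by
          gcongr
          exact hUx x hx
      _ ≤ 2 * Φ * V * k := by gcongr
      _ = 2 * Φ * (k * V) := by ring
      _ ≤ 2 * Φ * (2 * ‖v' 0‖) := by gcongr
      _ = 4 * Φ * ‖v' 0‖ := by ring
  · have e : (k : ℂ) / v' 0 * v x - (Real.sin (k * x) : ℂ) =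
        ((k : ℂ) * v x - v' 0 * (Real.sin (k * x) : ℂ)) / v' 0 := by
      field_simp
    rw [e, norm_div, div_le_div_iff₀ hd0 hk0]
    calc ‖(k : ℂ) * v x - v' 0 * (Real.sin (k * x) : ℂ)‖ * k ≤ 3 * Φ * V * k := by
          gcongr
          exact h7 x hx
      _ = 3 * Φ * (k * V) := by ring
      _ ≤ 3 * Φ * (2 * ‖v' 0‖) := by gcongr
      _ = 6 * Φ * ‖v' 0‖ := by ring

theorem EuclideanSpace.norm_le_add_fin_two (w : EuclideanSpace ℂ (Fin 2)) :
    ‖w‖ ≤ ‖w 0‖ + ‖w 1‖ := by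
  refine le_of_sq_le_sq ?_ (by positivity)
  rw [EuclideanSpace.norm_sq_eq, Fin.sum_univ_two]
  nlinarith [norm_nonneg (w 0), norm_nonneg (w 1)]

theorem exists_component_ne_zero {W G : ℝ → EuclideanSpace ℂ (Fin 2)} {μ : ℝ} {φ : ℝ → ℝ}
    (h : ClassicalM μ φ W G) (hW : W ≠ 0) : ∃ x ∈ Icc (0 : ℝ) 1, W x 0 ≠ 0 ∨ W x 1 ≠ 0 := by
  by_contra! hcon
  refine hW (funext fun x => ?_)
  by_cases hx : x ∈ Icc (0 : ℝ) 1
  · ext i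
    fin_cases i
    · exact (hcon x hx).1
    · exact (hcon x hx).2
  · exact h.2 x hx

section Asymptotics

variable {μ Φ b : ℝ} {φ : ℝ → ℝ} {W : ℝ → EuclideanSpace ℂ (Fin 2)}

theorem eigenfunction_pos_near_sin (hμ : 0 ≤ μ) (hφ : ContinuousOn φ (Icc 0 1))
    (hΦ : ∀ x ∈ Icc (0 : ℝ) 1, φ x ^ 2 ≤ Φ) (hk : 1 ≤ √(b - μ)) (hkΦ : 6 * Φ ≤ √(b - μ))
    (hW : IsEigenfunctionM μ φ (b : ℂ) W) :
    ∃ c : ℂ, c ≠ 0 ∧ ∀ x ∈ Icc (0 : ℝ) 1,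
      ‖c • W x - ((Real.sin (√(b - μ) * x) : ℝ) : ℂ) • !₂[(0 : ℂ), 1]‖ ≤
        10 * Φ / √(b - μ) := by
  have hcl := classicalM_of_mem_eigenspaceM hφ hW.1
  have hne := exists_component_ne_zero hcl hW.2
  obtain ⟨⟨u', v', hu, hv⟩, -⟩ := hcl
  have hb : 0 ≤ b - μ := (Real.sqrt_pos.1 (by linarith)).le
  have ek : ((√(b - μ) : ℝ) : ℂ) ^ 2 = b - μ := by
    rw [← Complex.ofReal_pow, Real.sq_sqrt hb, Complex.ofReal_sub]
  have eκ : ((√(b + μ) : ℝ) : ℂ) ^ 2 = b + μ := by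
    rw [← Complex.ofReal_pow, Real.sq_sqrt (by linarith), Complex.ofReal_add]
  obtain ⟨c, hc, h⟩ := exists_mul_near_sin (u := fun x => W x 0) (v := fun x => W x 1)
    (p := fun x => (φ x : ℂ) ^ 2) (κ := √(b + μ)) hk (Real.sqrt_le_sqrt (by linarith)) hkΦ
    (fun x hx => by simpa using hΦ x hx)
    (by
      convert hu using 1
      ext x
      simp only [eκ, Pi.smul_apply, PiLp.smul_apply, smul_eq_mul]
      ring)
    (by
      convert hv using 1
      ext x
      simp only [ek, Pi.smul_apply, PiLp.smul_apply, smul_eq_mul]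
      ring) hne
  refine ⟨c, hc, fun x hx => (EuclideanSpace.norm_le_add_fin_two _).trans ?_⟩
  have e : 10 * Φ / √(b - μ) = 4 * Φ / √(b - μ) + 6 * Φ / √(b - μ) := by ring
  rw [e]
  refine add_le_add ?_ ?_
  · simpa using (h x hx).1
  · simpa using (h x hx).2

/-- For negative eigenvalues the two components exchange their roles. -/
theorem eigenfunction_neg_near_sin (hμ : 0 ≤ μ) (hφ : ContinuousOn φ (Icc 0 1))
    (hΦ : ∀ x ∈ Icc (0 : ℝ) 1, φ x ^ 2 ≤ Φ) (hk : 1 ≤ √(b - μ)) (hkΦ : 6 * Φ ≤ √(b - μ))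
    (hW : IsEigenfunctionM μ φ ((-b : ℝ) : ℂ) W) :
    ∃ c : ℂ, c ≠ 0 ∧ ∀ x ∈ Icc (0 : ℝ) 1,
      ‖c • W x - ((Real.sin (√(b - μ) * x) : ℝ) : ℂ) • !₂[(1 : ℂ), 0]‖ ≤
        10 * Φ / √(b - μ) := by
  have hcl := classicalM_of_mem_eigenspaceM hφ hW.1
  obtain ⟨x₀, hx₀, hne⟩ := exists_component_ne_zero hcl hW.2
  obtain ⟨⟨u', v', hu, hv⟩, -⟩ := hcl
  have hb : 0 ≤ b - μ := (Real.sqrt_pos.1 (by linarith)).le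
  have ek : ((√(b - μ) : ℝ) : ℂ) ^ 2 = b - μ := by
    rw [← Complex.ofReal_pow, Real.sq_sqrt hb, Complex.ofReal_sub]
  have eκ : ((√(b + μ) : ℝ) : ℂ) ^ 2 = b + μ := by
    rw [← Complex.ofReal_pow, Real.sq_sqrt (by linarith), Complex.ofReal_add]
  obtain ⟨c, hc, h⟩ := exists_mul_near_sin (u := fun x => W x 1) (v := fun x => W x 0)
    (p := fun x => (φ x : ℂ) ^ 2) (κ := √(b + μ)) hk (Real.sqrt_le_sqrt (by linarith)) hkΦ
    (fun x hx => by simpa using hΦ x hx)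
    (by
      convert hv using 1
      ext x
      simp only [eκ, Pi.smul_apply, PiLp.smul_apply, smul_eq_mul, Complex.ofReal_neg]
      ring)
    (by
      convert hu using 1
      ext x
      simp only [ek, Pi.smul_apply, PiLp.smul_apply, smul_eq_mul, Complex.ofReal_neg]
      ring) ⟨x₀, hx₀, hne.symm⟩
  refine ⟨c, hc, fun x hx => (EuclideanSpace.norm_le_add_fin_two _).trans ?_⟩
  have e : 10 * Φ / √(b - μ) = 6 * Φ / √(b - μ) + 4 * Φ / √(b - μ) := by ring
  rw [e]
  refine add_le_add ?_ ?_
  · simpa using (h x hx).2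
  · simpa using (h x hx).1

end Asymptotics

/-! ### Conclusion -/

/-- Linear growth of the frequencies `√(β_n - μ)`. -/
theorem IsPosEigenvalueList.div_le_sqrt {μ Φ : ℝ} {φ : ℝ → ℝ} {β : ℕ → ℝ} (hμ : 0 ≤ μ)
    (hφ : ContinuousOn φ (Icc 0 1)) (hΦ : ∀ x ∈ Icc (0 : ℝ) 1, φ x ^ 2 ≤ Φ)
    (hβ : IsPosEigenvalueList μ φ β) {n : ℕ} (hn : 2 ≤ n) (hnΦ : 20000 * (4 * Φ + μ) ≤ n) :
    (n : ℝ) / 100 ≤ √(β n - μ) := by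
  have hΦ0 : 0 ≤ Φ := (sq_nonneg _).trans (hΦ 0 (by simp))
  have hβn := hβ.pos n hn
  have hn' : (2 : ℝ) ≤ n := by exact_mod_cast hn
  have hs2 : √(β n + 4 * Φ) ^ 2 = β n + 4 * Φ := Real.sq_sqrt (by linarith)
  have h := hβ.sub_one_le hμ hφ hΦ (s := √(β n + 4 * Φ)) (Real.sqrt_pos.2 (by linarith))
    (by linarith) hn (by linarith)
  have h1 : (n : ℝ) / 80 ≤ √(β n + 4 * Φ) := by linarith
  have h2 : ((n : ℝ) / 80) ^ 2 ≤ β n + 4 * Φ := by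
    rw [← hs2]
    gcongr
  refine Real.le_sqrt_of_sq_le ?_
  -- `4 Φ + μ ≤ n / 20000 ≤ n² / 20000`, and `1 / 80² - 1 / 20000 ≥ 1 / 100²`.
  nlinarith

theorem mainTheorem6 (μ : ℝ) (hμ : 0 < μ) (φ : ℝ → ℝ) (hφ : IsGroundState μ φ)
    (β : ℕ → ℝ) (hβ : IsPosEigenvalueList μ φ β) :
    ∃ n₀ : ℕ, ∃ C : ℝ, 2 ≤ n₀ ∧ 0 < C ∧ ∀ n : ℕ, n₀ ≤ n →
      μ < β n ∧
      (∀ W : ℝ → EuclideanSpace ℂ (Fin 2), IsEigenfunctionM μ φ ((β n : ℝ) : ℂ) W →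
        ∃ c : ℂ, c ≠ 0 ∧ ∀ x ∈ Set.Icc (0 : ℝ) 1,
          ‖c • W x - ((Real.sin (Real.sqrt (β n - μ) * x) : ℝ) : ℂ) • !₂[(0 : ℂ), 1]‖
            ≤ C / n) ∧
      (∀ W : ℝ → EuclideanSpace ℂ (Fin 2), IsEigenfunctionM μ φ ((-β n : ℝ) : ℂ) W →
        ∃ c : ℂ, c ≠ 0 ∧ ∀ x ∈ Set.Icc (0 : ℝ) 1,
          ‖c • W x - ((Real.sin (Real.sqrt (β n - μ) * x) : ℝ) : ℂ) • !₂[(1 : ℂ), 0]‖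
            ≤ C / n) := by
  have hc := hφ.continuousOn
  obtain ⟨A, hA⟩ := isCompact_Icc.exists_bound_of_continuousOn hc
  have hΦ : ∀ x ∈ Icc (0 : ℝ) 1, φ x ^ 2 ≤ A ^ 2 := fun x hx => sq_le_sq.2
    ((hA x hx).trans (le_abs_self A))
  have hΦ0 : 0 ≤ A ^ 2 := sq_nonneg A
  generalize A ^ 2 = Φ at hΦ hΦ0
  -- For such `n` the frequency `√(β n - μ)` is at least `n / 100`, hence at least `1` and `6 Φ`.
  refine ⟨⌈20000 * (4 * Φ + μ)⌉₊ + 100, 1000 * Φ + 1, by omega, by positivity, fun n hn => ?_⟩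
  have hn1 : 20000 * (4 * Φ + μ) ≤ n := (Nat.le_ceil _).trans (by exact_mod_cast by omega)
  have hn2 : (100 : ℝ) ≤ n := by exact_mod_cast (by omega : 100 ≤ n)
  have hk := hβ.div_le_sqrt hμ.le hc hΦ (by omega) hn1
  have hk1 : 1 ≤ √(β n - μ) := by linarith
  have hkΦ : 6 * Φ ≤ √(β n - μ) := by linarith
  have hC : 10 * Φ / √(β n - μ) ≤ (1000 * Φ + 1) / n := by
    rw [div_le_div_iff₀ (by linarith) (by linarith)]
    nlinarith
  refine ⟨?_, fun W hW => ?_, fun W hW => ?_⟩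
  · linarith [Real.sqrt_pos.1 (zero_lt_one.trans_le hk1)]
  · obtain ⟨c, hc0, h⟩ := eigenfunction_pos_near_sin hμ.le hc hΦ hk1 hkΦ hW
    exact ⟨c, hc0, fun x hx => (h x hx).trans hC⟩
  · obtain ⟨c, hc0, h⟩ := eigenfunction_neg_near_sin hμ.le hc hΦ hk1 hkΦ hW
    exact ⟨c, hc0, fun x hx => (h x hx).trans hC⟩
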